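/- Model. A network is a finite connected undirected graph $G=(V,E,\omega)$ with $n$ nodes, positive integer edge weights $\omega$ and weighted diameter $D_\omega$. The nodes have distinct identifiers in $\{1,\dots,n^{a}\}$ for a constant $a$. Each node knows its identifier, $n$, the smallest identifier, the identifiers of its neighbours and the weights of the edges to them, whether it belongs to a given nonempty set $S\subseteq V$, and $|S|$. Computation proceeds in synchronous rounds; in each round every node may send one message of $O(\log (n+D_\omega))$ bits (a constant number of identifiers, distances and routing costs) to each neighbour. For a subgraph $T$ containing $S$ let $RC_S(T)=\sum_{u,v\in S}\omega_T(u,v)$, where $\omega_T$ is the weighted distance in $T$. The $S$-minimum routing cost tree problem asks for a subtree $T$ of $G$ that spans $S$ and minimizes $RC_S(T)$. Theorem. Assume that either all edge weights are equal and a message takes one round to cross an edge, or a message takes exactly $\omega(e)$ rounds to cross the edge $e$ (a new message may enter the edge in every round). There is a deterministic distributed algorithm, MRCT, the same for all networks, that computes a $(\times,2)$-approximation of the $S$-minimum routing cost tree problem in $O(|S|+D_\omega)$ rounds, the constant being absolute. More precisely, within this time all nodes terminate, and there are spanning trees $T_r$ of $G$, one for each $r\in S$, such that 1. $T_r$ is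 a shortest-path tree of $G$ with root $r$, and every node $u$ knows its parent in $T_r$ and its distance $\omega(r,u)$, for all $r\in S$; 2. every node $u$ knows, for all $r\in S$, the number $z_r(u)$ of nodes of $S$ in the subtree of $T_r$ below $u$ and the value $rc_r(u)$ given by the recursion $rc_r(u)=\sum_{c}\bigl(rc_r(c)+\omega(u,c)\,z_r(c)\,(|S|-z_r(c))\bigr)$ over the children $c$ of $u$ in $T_r$; at the root, $2\,rc_r(r)=RC_S(T_r)$; 3. every node knows (the identifier of) one and the same node $v\in S$ such that $RC_S(T_v)=\min_{r\in S}RC_S(T_r)$, and $\mathrm{OPT}\le RC_S(T_v)\le 2\,\mathrm{OPT}$, where $\mathrm{OPT}$ is the minimum of $RC_S(T)$ over all subtrees $T$ of $G$ that span $S$. -/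

import Mathlib

noncomputable section

namespace MRCT

/-! ## Weighted graphs, routing cost, and the minimum routing cost tree problem -/

section Graphs

variable {V : Type}

/-- Total weight of a walk: the sum of the weights of its edges. -/
def walkWeight {H : SimpleGraph V} (w : Sym2 V → ℕ) {u v : V} (p : H.Walk u v) : ℕ :=
  (p.edges.map w).sum

/-- Weighted distance between `u` and `v` using only edges of `H`: the least weight of a
`u`-`v`-walk of `H`.  (Only used for vertices that are connected in `H`.) -/
def wdist (H : SimpleGraph V) (w : Sym2 V → ℕ) (u v : V) : ℕ :=
  sInf (Set.range fun p : H.Walk u v => walkWeight w p)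

/-- `T` is a subtree of `G` that spans `S`. -/
def SpansAsTree (G : SimpleGraph V) (S : Finset V) (T : G.Subgraph) : Prop :=
  T.coe.IsTree ∧ (S : Set V) ⊆ T.verts

/-- Routing cost of a subgraph `T` with respect to `S`: the sum over all (ordered) pairs
`u, v ∈ S` of the distance from `u` to `v` inside `T`. -/
def routingCost {G : SimpleGraph V} (w : Sym2 V → ℕ) (S : Finset V) (T : G.Subgraph) : ℕ :=
  ∑ u ∈ S, ∑ v ∈ S, wdist T.spanningCoe w u v

/-- Optimal value of the `S`-minimum routing cost tree problem on `(G, w)`. -/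
def optRoutingCost (G : SimpleGraph V) (w : Sym2 V → ℕ) (S : Finset V) : ℕ :=
  sInf {c | ∃ T : G.Subgraph, SpansAsTree G S T ∧ c = routingCost w S T}

/-- One-sided multiplicative approximation with factor `ρ` for a minimization problem. -/
def IsMulApprox (ρ opt sol : ℕ) : Prop :=
  opt ≤ sol ∧ sol ≤ ρ * opt

/-- `T` is a spanning tree of `G` in which every node is at its `G`-distance from `r`. -/
def IsShortestPathTree (G : SimpleGraph V) (w : Sym2 V → ℕ) (r : V) (T : G.Subgraph) : Prop :=
  T.IsSpanning ∧ T.coe.IsTree ∧ ∀ u, wdist T.spanningCoe w r u = wdist G w r u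

end Graphs

/-! ## Networks and synchronous message-passing algorithms -/

/-- A network: a finite connected graph with positive integer edge weights and distinct
positive node identifiers.  `latency e` is the number of rounds that a message needs to
travel through the edge `e`. -/
structure Network (V : Type) [Fintype V] where
  graph : SimpleGraph V
  connected : graph.Connected
  weight : Sym2 V → ℕ
  weight_pos : ∀ e ∈ graph.edgeSet, 0 < weight e
  latency : Sym2 V → ℕ
  latency_pos : ∀ e ∈ graph.edgeSet, 0 < latency e
  ident : V → ℕ
  ident_injective : Function.Injective ident
  ident_pos : ∀ v, 0 < ident v

/-- What a node knows at the beginning: its own identifier, the number of nodes of the network,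
the smallest identifier, the identifiers of its neighbors together with the weights of the
connecting edges, whether it belongs to `S`, and the size of `S`. -/
structure LocalInput where
  ident : ℕ
  numNodes : ℕ
  minIdent : ℕ
  links : Finset (ℕ × ℕ)
  inS : Prop
  sizeS : ℕ

/-- A message is a string of bits. -/
abbrev Message := List Bool

/-- A deterministic synchronous message-passing algorithm.  In every round, each node may send,
to each neighbor separately (addressed by its identifier), at most one message that depends on
its state, and then updates its state from the messages that arrive (indexed by the identifier
of the neighbor they come from).  `output s = some o` means that the node has terminated with
result `o`.  Local computation is free. -/
structure Algorithm (Out : Type) where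
  State : Type
  init : LocalInput → State
  send : State → ℕ → Option Message
  step : State → (ℕ → Option Message) → State
  output : State → Option Out

section Execution

variable {V : Type} [Fintype V]

open scoped Classical in
/-- The initial knowledge of node `u`. -/
def Network.localInput (N : Network V) (S : Finset V) (u : V) : LocalInput where
  ident := N.ident u
  numNodes := Fintype.card V
  minIdent := sInf (Set.range N.ident)
  links := (Finset.univ.filter fun v => N.graph.Adj u v).image
    fun v => (N.ident v, N.weight s(u, v))
  inS := u ∈ S
  sizeS := S.card

open scoped Classical in
/-- The neighbor of `u` whose identifier is `i`, if there is one. -/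
def Network.neighbor (N : Network V) (u : V) (i : ℕ) : Option V :=
  if h : ∃ v, N.graph.Adj u v ∧ N.ident v = i then some h.choose else none

/-- The state of node `u` after `t` rounds.  A message that is sent through an edge of latency
`ℓ` on the basis of the state at time `t'` enters the state of the recipient at time `t' + ℓ`. -/
def Network.run {Out : Type} (N : Network V) (S : Finset V) (A : Algorithm Out) :
    ℕ → V → A.State
  | 0, u => A.init (N.localInput S u)
  | t + 1, u =>
    A.step (N.run S A t u) fun i =>
      (N.neighbor u i).bind fun v =>
        if _h : 0 < N.latency s(u, v) ∧ N.latency s(u, v) ≤ t + 1 then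
          A.send (N.run S A (t + 1 - N.latency s(u, v)) v) (N.ident u)
        else none
termination_by t => t
decreasing_by all_goals omega

/-- No message that is ever sent has more than `B` bits. -/
def Network.BandwidthAtMost {Out : Type} (N : Network V) (S : Finset V) (A : Algorithm Out)
    (B : ℕ) : Prop :=
  ∀ (t : ℕ) (u v : V), N.graph.Adj u v →
    ∀ m ∈ A.send (N.run S A t u) (N.ident v), m.length ≤ B

/-- Every node `u` terminates within `T` rounds, irrevocably, with result `out u`. -/
def Network.TerminatesWithin {Out : Type} (N : Network V) (S : Finset V) (A : Algorithm Out)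
    (T : ℕ) (out : V → Out) : Prop :=
  ∀ u, ∃ t ≤ T, (∀ s < t, A.output (N.run S A s u) = none) ∧
    ∀ s, t ≤ s → A.output (N.run S A s u) = some (out u)

/-- Weighted diameter. -/
def Network.diam (N : Network V) : ℕ :=
  Finset.univ.sup fun u => Finset.univ.sup fun v => wdist N.graph N.weight u v

/-- All edges have the same weight, and every message arrives after one round. -/
def Network.UniformWeights (N : Network V) : Prop :=
  (∃ c, ∀ e ∈ N.graph.edgeSet, N.weight e = c) ∧ ∀ e ∈ N.graph.edgeSet, N.latency e = 1

/-- The weight of each edge is the time that a message needs to travel through it. -/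
def Network.TransmissionWeights (N : Network V) : Prop :=
  ∀ e ∈ N.graph.edgeSet, N.latency e = N.weight e

end Execution

/-! ## The result of the algorithm -/

/-- The variables held by a node at the end.  `parent r`, `dist r`, `subtreeSize r` and
`subtreeCost r` refer to the tree whose root has identifier `r`; `best` is the identifier of
the root of the selected tree. -/
structure Result where
  parent : ℕ → Option ℕ
  dist : ℕ → ℕ
  subtreeSize : ℕ → ℕ
  subtreeCost : ℕ → ℕ
  best : ℕ

section Results

variable {V : Type} [Fintype V]

/-- The nodes store the shortest-path tree `T` with root `r`: each node knows its distance to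
`r`, and the edges of `T` are exactly those between a node and its parent. -/
def Network.StoresTree (N : Network V) (out : V → Result) (r : V) (T : N.graph.Subgraph) : Prop :=
  IsShortestPathTree N.graph N.weight r T ∧
  (∀ u, (out u).dist (N.ident r) = wdist N.graph N.weight r u) ∧
  (out r).parent (N.ident r) = none ∧
  ∀ u v, T.Adj u v ↔
    (out u).parent (N.ident r) = some (N.ident v) ∨ (out v).parent (N.ident r) = some (N.ident u)

/-- The children of `u` in the stored tree with root `r`. -/
def Network.children (N : Network V) (out : V → Result) (r u : V) : Finset V :=
  Finset.univ.filter fun c => (out c).parent (N.ident r) = some (N.ident u)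

open scoped Classical in
/-- The nodes store the routing costs of the tree with root `r`, computed recursively from the
leaves: `subtreeSize` is the number of nodes of `S` in the subtree below `u`, and each edge from
`u` to a child `c` contributes its weight times the number of (unordered) pairs of nodes of `S`
that it separates. -/
def Network.StoresCosts (N : Network V) (S : Finset V) (out : V → Result) (r : V) : Prop :=
  ∀ u,
    (out u).subtreeSize (N.ident r) =
      (if u ∈ S then 1 else 0) + ∑ c ∈ N.children out r u, (out c).subtreeSize (N.ident r) ∧
    (out u).subtreeCost (N.ident r) =
      ∑ c ∈ N.children out r u, ((out c).subtreeCost (N.ident r) +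
        N.weight s(u, c) * (out c).subtreeSize (N.ident r) *
          (S.card - (out c).subtreeSize (N.ident r)))

end Results

end MRCT

end

/-!
Every node `u` announces its distance to the source `r ∈ S` in the round
`slot r u = d(r, u) + #{r' ∈ S | r' precedes r at u}`, where the sources are ordered at `u` by
distance and, among equal distances, by identifier. Along the edge from `u` to its parent on a
shortest path to `r` no source enters the set of predecessors of `r`, so the slot drops by at least
the weight of the edge. Hence, if the latency of an edge is at most its weight, the announcement of
the parent arrives in time, while an estimate that is not yet final never falls due. Each node makes
at most one announcement per round, and all slots are at most `D + |S|`.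

The nodes that have made all their announcements are counted up the tree of the smallest source,
which therefore learns that everybody is done and floods a common time `B = O(D + |S|)`. After that,
the subtree sizes and costs travel up all trees at once by running the announcements backwards: the
report about `r` leaves `u` in round `3 * B - slot r u`, when all children of `u` have reported.
Finally the cheapest root is flooded.

A tree distance is the sum of the weights of the edges separating the two nodes, and the edge above
`c` separates `z (|S| - z)` pairs of sources, `z` of which lie below `c`; this gives the recursion
for the routing cost. For the approximation factor, `RC(T_r) ≤ 2 |S| ∑_{u ∈ S} d(r, u)`, and
averaging this over `r ∈ S` gives at most twice the optimum.
-/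

noncomputable section

namespace MRCT

/-! ## Weighted distances -/

section Distances

variable {V : Type} {H : SimpleGraph V} {w : Sym2 V → ℕ}

theorem walkWeight_nil (u : V) : walkWeight w (SimpleGraph.Walk.nil : H.Walk u u) = 0 := by
  simp [walkWeight]

theorem walkWeight_cons {u v x : V} (h : H.Adj u v) (p : H.Walk v x) :
    walkWeight w (SimpleGraph.Walk.cons h p) = w s(u, v) + walkWeight w p := by
  simp [walkWeight]

theorem walkWeight_append {u v x : V} (p : H.Walk u v) (q : H.Walk v x) :
    walkWeight w (p.append q) = walkWeight w p + walkWeight w q := by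
  simp [walkWeight, SimpleGraph.Walk.edges_append]

theorem walkWeight_reverse {u v : V} (p : H.Walk u v) :
    walkWeight w p.reverse = walkWeight w p := by
  simp [walkWeight, SimpleGraph.Walk.edges_reverse]

theorem wdist_le_walkWeight {u v : V} (p : H.Walk u v) : wdist H w u v ≤ walkWeight w p :=
  Nat.sInf_le ⟨p, rfl⟩

theorem exists_walkWeight_eq_wdist {u v : V} (h : H.Reachable u v) :
    ∃ p : H.Walk u v, walkWeight w p = wdist H w u v := by
  obtain ⟨p⟩ := h
  exact Nat.sInf_mem (s := Set.range fun p : H.Walk u v => walkWeight w p) ⟨_, p, rfl⟩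

theorem wdist_self (u : V) : wdist H w u u = 0 :=
  Nat.le_zero.1 ((wdist_le_walkWeight SimpleGraph.Walk.nil).trans_eq (walkWeight_nil u))

theorem wdist_comm (u v : V) : wdist H w u v = wdist H w v u := by
  unfold wdist
  congr 1
  ext c
  constructor <;> rintro ⟨p, rfl⟩ <;> exact ⟨p.reverse, walkWeight_reverse p⟩

theorem wdist_triangle (hc : H.Connected) (u v x : V) :
    wdist H w u x ≤ wdist H w u v + wdist H w v x := by
  obtain ⟨p, hp⟩ := exists_walkWeight_eq_wdist (w := w) (hc u v)
  obtain ⟨q, hq⟩ := exists_walkWeight_eq_wdist (w := w) (hc v x)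
  rw [← hp, ← hq, ← walkWeight_append]
  exact wdist_le_walkWeight _

theorem wdist_le_of_adj {u v : V} (h : H.Adj u v) : wdist H w u v ≤ w s(u, v) := by
  simpa [walkWeight_cons, walkWeight_nil] using
    wdist_le_walkWeight (w := w) (SimpleGraph.Walk.cons h SimpleGraph.Walk.nil)

theorem wdist_le_weight_add_wdist (hc : H.Connected) {u v : V} (h : H.Adj u v) (x : V) :
    wdist H w u x ≤ w s(u, v) + wdist H w v x :=
  (wdist_triangle hc u v x).trans (Nat.add_le_add_right (wdist_le_of_adj h) _)

theorem exists_adj_wdist_add_weight (hc : H.Connected) {r u : V} (h : u ≠ r) :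
    ∃ v, H.Adj u v ∧ wdist H w r v + w s(u, v) = wdist H w r u := by
  obtain ⟨p, hp⟩ := exists_walkWeight_eq_wdist (w := w) (hc u r)
  cases p with
  | nil => exact absurd rfl h
  | @cons _ v _ hadj q =>
    refine ⟨v, hadj, ?_⟩
    have hle := wdist_le_weight_add_wdist (w := w) hc hadj r
    have hq := wdist_le_walkWeight (w := w) q
    rw [walkWeight_cons] at hp
    rw [wdist_comm r v, wdist_comm r u]
    omega

theorem wdist_anti {H' : SimpleGraph V} (hle : H' ≤ H) {u v : V} (h : H'.Reachable u v) :
    wdist H w u v ≤ wdist H' w u v := by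
  obtain ⟨p, hp⟩ := exists_walkWeight_eq_wdist (w := w) h
  rw [← hp]
  simpa [walkWeight, SimpleGraph.Walk.edges_mapLe_eq_edges] using
    wdist_le_walkWeight (w := w) (p.mapLe hle)

theorem le_walkWeight {d : V → V → ℕ} (hself : ∀ u, d u u = 0)
    (htri : ∀ u v x, d u x ≤ d u v + d v x) (hadj : ∀ u v, H.Adj u v → d u v ≤ w s(u, v))
    {u v : V} (p : H.Walk u v) : d u v ≤ walkWeight w p := by
  induction p with
  | nil => simp [hself]
  | @cons a b c h p ih =>
    rw [walkWeight_cons]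
    exact (htri a b c).trans (Nat.add_le_add (hadj a b h) ih)

end Distances

/-! ## Rooted trees given by parent maps -/

section RootedTrees

variable {V : Type}

/-- Parent maps of rooted trees: `P` fixes the root `r`, and every vertex reaches `r` by
iterating `P`. -/
structure IsRooted (P : V → V) (r : V) : Prop where
  root : P r = r
  reaches : ∀ u, ∃ k, P^[k] u = r

/-- The graph whose edges join every vertex to its image under the parent map `P`. -/
def parentGraph (P : V → V) : SimpleGraph V :=
  SimpleGraph.fromRel fun u v => P u = v

variable {P : V → V} {r u v : V}

theorem parentGraph_adj :
    (parentGraph P).Adj u v ↔ u ≠ v ∧ (P u = v ∨ P v = u) :=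
  SimpleGraph.fromRel_adj _ u v

namespace IsRooted

theorem eq_root_of_isPeriodicPt (hP : IsRooted P r) {k : ℕ} (hk : 0 < k)
    (h : Function.IsPeriodicPt P k u) : u = r := by
  obtain ⟨m, hm⟩ := hP.reaches u
  have hle : m ≤ k * m := Nat.le_mul_of_pos_left m hk
  calc u = P^[k * m - m + m] u := by rw [Nat.sub_add_cancel hle, (h.mul_const m).eq]
    _ = r := by rw [Function.iterate_add_apply, hm, Function.iterate_fixed hP.root]

theorem parent_ne (hP : IsRooted P r) (hu : u ≠ r) : P u ≠ u := fun h =>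
  hu (hP.eq_root_of_isPeriodicPt one_pos h)

theorem parentGraph_adj_parent (hP : IsRooted P r) (hu : u ≠ r) :
    (parentGraph P).Adj u (P u) :=
  parentGraph_adj.2 ⟨(hP.parent_ne hu).symm, Or.inl rfl⟩

theorem parentGraph_reachable (hP : IsRooted P r) (u : V) : (parentGraph P).Reachable u r := by
  obtain ⟨k, hk⟩ := hP.reaches u
  induction k generalizing u with
  | zero => exact hk ▸ SimpleGraph.Reachable.refl u
  | succ k ih =>
    by_cases hu : u = r
    · exact hu ▸ SimpleGraph.Reachable.refl u
    · exact (hP.parentGraph_adj_parent hu).reachable.trans (ih (P u) hk)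

theorem parentGraph_connected (hP : IsRooted P r) : (parentGraph P).Connected :=
  have : Nonempty V := ⟨r⟩
  ⟨fun u v => (hP.parentGraph_reachable u).trans (hP.parentGraph_reachable v).symm⟩

theorem parentGraph_isTree [Finite V] (hP : IsRooted P r) : (parentGraph P).IsTree := by
  classical
  cases nonempty_fintype V
  have hconn := hP.parentGraph_connected
  have hsub : (parentGraph P).edgeSet ⊆
      ((Finset.univ.erase r).image fun u => s(u, P u) : Finset (Sym2 V)) := by
    have mem {u : V} (hu : P u ≠ u) : s(u, P u) ∈ (Finset.univ.erase r).image fun u => s(u, P u) :=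
      Finset.mem_image_of_mem _
        (Finset.mem_erase.2 ⟨fun h => hu (h ▸ hP.root), Finset.mem_univ u⟩)
    intro e
    induction e using Sym2.ind with
    | _ u v =>
      intro h
      obtain ⟨hne, rfl | rfl⟩ := parentGraph_adj.1 ((SimpleGraph.mem_edgeSet _).1 h)
      exacts [mem hne.symm, Sym2.eq_swap ▸ mem hne]
  rw [SimpleGraph.isTree_iff_connected_and_card]
  refine ⟨hconn, le_antisymm ?_ hconn.card_vert_le_card_edgeSet_add_one⟩
  calc Nat.card (parentGraph P).edgeSet + 1
      ≤ ((Finset.univ.erase r).image fun u => s(u, P u)).card + 1 := by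
        rw [← Set.ncard_coe_finset]
        exact Nat.add_le_add_right (Set.ncard_le_ncard hsub (Finset.finite_toSet _)) 1
    _ ≤ (Finset.univ.erase r).card + 1 := Nat.add_le_add_right Finset.card_image_le 1
    _ = Nat.card V := by
        rw [Finset.card_erase_add_one (Finset.mem_univ r), Finset.card_univ,
          Nat.card_eq_fintype_card]

end IsRooted

variable [Fintype V]

open Classical in
/-- The vertices of the subtree below `u`, including `u`. -/
def descendants (P : V → V) (u : V) : Finset V := {y | ∃ k, P^[k] y = u}

open Classical in
/-- The children of `u`; a root, being its own parent, is not among its children. -/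
def childrenOf (P : V → V) (u : V) : Finset V := {c | c ≠ u ∧ P c = u}

open Classical in
/-- The distance in the tree with parent map `P`, as the total weight of the edges that
separate `u` from `v`; the edge from `x` to its parent is represented by `x`. -/
def cutDist (w : Sym2 V → ℕ) (P : V → V) (u v : V) : ℕ :=
  ∑ x, if u ∈ descendants P x ↔ v ∈ descendants P x then 0 else w s(x, P x)

variable {w : Sym2 V → ℕ}

theorem mem_descendants : v ∈ descendants P u ↔ ∃ k, P^[k] v = u := by
  simp [descendants]

theorem mem_childrenOf : v ∈ childrenOf P u ↔ v ≠ u ∧ P v = u := by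
  simp [childrenOf]

theorem self_mem_descendants (P : V → V) (u : V) : u ∈ descendants P u :=
  mem_descendants.2 ⟨0, rfl⟩

theorem mem_descendants_iff_parent (h : v ≠ u) :
    v ∈ descendants P u ↔ P v ∈ descendants P u := by
  simp only [mem_descendants]
  constructor
  · rintro ⟨_ | k, hk⟩
    exacts [absurd hk h, ⟨k, hk⟩]
  · rintro ⟨k, hk⟩
    exact ⟨k + 1, hk⟩

theorem mem_descendants_or_mem_descendants {y : V} (hu : y ∈ descendants P u)
    (hv : y ∈ descendants P v) : u ∈ descendants P v ∨ v ∈ descendants P u := by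
  obtain ⟨k, rfl⟩ := mem_descendants.1 hu
  obtain ⟨l, rfl⟩ := mem_descendants.1 hv
  simp only [mem_descendants, ← Function.iterate_add_apply]
  rcases le_total k l with h | h
  · exact Or.inl ⟨l - k, by rw [Nat.sub_add_cancel h]⟩
  · exact Or.inr ⟨k - l, by rw [Nat.sub_add_cancel h]⟩

theorem descendants_eq_insert [DecidableEq V] (P : V → V) (u : V) :
    descendants P u = insert u ((childrenOf P u).biUnion (descendants P)) := by
  ext y
  simp only [Finset.mem_insert, Finset.mem_biUnion, mem_childrenOf, mem_descendants]
  constructor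
  · rintro ⟨k, hk⟩
    induction k generalizing y with
    | zero => exact Or.inl hk
    | succ k ih =>
      by_cases hy : y = u
      · exact Or.inl hy
      rcases ih (P y) hk with h | ⟨c, hc, j, hj⟩
      · exact Or.inr ⟨y, ⟨hy, h⟩, 0, rfl⟩
      · exact Or.inr ⟨c, hc, j + 1, hj⟩
  · rintro (rfl | ⟨c, ⟨_, rfl⟩, k, rfl⟩)
    · exact ⟨0, rfl⟩
    · exact ⟨k + 1, Function.iterate_succ_apply' P k y⟩

theorem cutDist_self (w : Sym2 V → ℕ) (P : V → V) (u : V) : cutDist w P u u = 0 := by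
  simp [cutDist]

theorem cutDist_comm (w : Sym2 V → ℕ) (P : V → V) (u v : V) :
    cutDist w P u v = cutDist w P v u := by
  refine Finset.sum_congr rfl fun x _ => ?_
  split_ifs <;> tauto

theorem cutDist_triangle (w : Sym2 V → ℕ) (P : V → V) (u v x : V) :
    cutDist w P u x ≤ cutDist w P u v + cutDist w P v x := by
  rw [cutDist, cutDist, cutDist, ← Finset.sum_add_distrib]
  refine Finset.sum_le_sum fun y _ => ?_
  split_ifs <;> first | omega | tauto

theorem cutDist_parent_le (w : Sym2 V → ℕ) (P : V → V) (u : V) :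
    cutDist w P u (P u) ≤ w s(u, P u) := by
  classical
  calc cutDist w P u (P u) ≤ ∑ x, if u = x then w s(x, P x) else 0 :=
        Finset.sum_le_sum fun x _ => by
          by_cases hx : u = x
          · rw [if_pos hx]
            split_ifs <;> omega
          · simp [mem_descendants_iff_parent hx]
    _ = w s(u, P u) := by simp

namespace IsRooted

theorem mem_descendants_root (hP : IsRooted P r) (u : V) : u ∈ descendants P r :=
  mem_descendants.2 (hP.reaches u)

theorem descendants_root (hP : IsRooted P r) : descendants P r = Finset.univ :=
  Finset.eq_univ_of_forall hP.mem_descendants_root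

theorem descendants_antisymm (hP : IsRooted P r) (hu : u ∈ descendants P v)
    (hv : v ∈ descendants P u) : u = v := by
  obtain ⟨k, rfl⟩ := mem_descendants.1 hu
  obtain ⟨l, hl⟩ := mem_descendants.1 hv
  rcases Nat.eq_zero_or_pos k with rfl | hk
  · rfl
  · have hroot : u = r := hP.eq_root_of_isPeriodicPt (k := l + k) (by omega)
      (by rwa [Function.IsPeriodicPt, Function.IsFixedPt, Function.iterate_add_apply])
    rw [hroot, Function.iterate_fixed hP.root]

theorem notMem_descendants_of_mem_childrenOf (hP : IsRooted P r) (hv : v ∈ childrenOf P u) :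
    u ∉ descendants P v := fun h =>
  (mem_childrenOf.1 hv).1
    (hP.descendants_antisymm (mem_descendants.2 ⟨1, (mem_childrenOf.1 hv).2⟩) h)

theorem disjoint_descendants (hP : IsRooted P r) {c c' : V} (hc : c ∈ childrenOf P u)
    (hc' : c' ∈ childrenOf P u) (hne : c ≠ c') :
    Disjoint (descendants P c) (descendants P c') := by
  have notMem {c c' : V} (hc : c ∈ childrenOf P u) (hc' : c' ∈ childrenOf P u) (hne : c ≠ c') :
      c ∉ descendants P c' := by
    rw [mem_descendants_iff_parent hne, (mem_childrenOf.1 hc).2]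
    exact hP.notMem_descendants_of_mem_childrenOf hc'
  refine Finset.disjoint_left.2 fun y hy hy' => ?_
  rcases mem_descendants_or_mem_descendants hy hy' with h | h
  exacts [notMem hc hc' hne h, notMem hc' hc hne.symm h]

theorem sum_descendants {M : Type*} [AddCommMonoid M] (hP : IsRooted P r) (f : V → M) (u : V) :
    ∑ y ∈ descendants P u, f y = f u + ∑ c ∈ childrenOf P u, ∑ y ∈ descendants P c, f y := by
  classical
  rw [descendants_eq_insert, Finset.sum_insert, Finset.sum_biUnion]
  · exact fun c hc c' hc' => hP.disjoint_descendants hc hc'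
  · simp only [Finset.mem_biUnion, not_exists, not_and]
    exact fun c => hP.notMem_descendants_of_mem_childrenOf

theorem cutDist_eq_weight_add (hP : IsRooted P r) (h : v ∉ descendants P u) :
    cutDist w P u v = w s(u, P u) + cutDist w P (P u) v := by
  classical
  have hu : u ≠ r := fun hu => h (hu ▸ hP.mem_descendants_root v)
  have hPu : P u ∉ descendants P u := fun hmem =>
    hP.parent_ne hu (hP.descendants_antisymm hmem (mem_descendants.2 ⟨1, rfl⟩))
  have hsum : w s(u, P u) = ∑ x, if x = u then w s(x, P x) else 0 := by simp
  rw [hsum, cutDist, cutDist, ← Finset.sum_add_distrib]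
  refine Finset.sum_congr rfl fun x _ => ?_
  by_cases hx : x = u
  · subst hx
    simp [h, hPu, self_mem_descendants]
  · simp [mem_descendants_iff_parent (Ne.symm hx), hx]

theorem wdist_le_cutDist_of_notMem (hP : IsRooted P r) (hv : v ∉ descendants P u)
    (h : wdist (parentGraph P) w (P u) v ≤ cutDist w P (P u) v) :
    wdist (parentGraph P) w u v ≤ cutDist w P u v := by
  have hu : u ≠ r := fun hu => hv (hu ▸ hP.mem_descendants_root v)
  rw [hP.cutDist_eq_weight_add hv]
  exact (wdist_le_weight_add_wdist hP.parentGraph_connected (hP.parentGraph_adj_parent hu) v).trans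
    (Nat.add_le_add_left h _)

theorem wdist_le_cutDist_of_mem (hP : IsRooted P r) (hu : u ∈ descendants P v) :
    wdist (parentGraph P) w u v ≤ cutDist w P u v := by
  obtain ⟨k, hk⟩ := mem_descendants.1 hu
  induction k generalizing u with
  | zero => exact (congrArg _ hk.symm).trans (wdist_self u) |>.trans_le (Nat.zero_le _)
  | succ k ih =>
    by_cases hv : v ∈ descendants P u
    · rw [hP.descendants_antisymm hu hv, wdist_self]
      exact Nat.zero_le _
    · exact hP.wdist_le_cutDist_of_notMem hv (ih (mem_descendants.2 ⟨k, hk⟩) hk)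

theorem wdist_le_cutDist (hP : IsRooted P r) (u v : V) :
    wdist (parentGraph P) w u v ≤ cutDist w P u v := by
  obtain ⟨k, hk⟩ := hP.reaches u
  induction k generalizing u with
  | zero =>
    obtain rfl : u = r := hk
    rw [wdist_comm, cutDist_comm]
    exact hP.wdist_le_cutDist_of_mem (hP.mem_descendants_root v)
  | succ k ih =>
    by_cases hv : v ∈ descendants P u
    · rw [wdist_comm, cutDist_comm]
      exact hP.wdist_le_cutDist_of_mem hv
    · exact hP.wdist_le_cutDist_of_notMem hv (ih (P u) hk)

theorem cutDist_le_wdist (hP : IsRooted P r) (u v : V) :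
    cutDist w P u v ≤ wdist (parentGraph P) w u v := by
  obtain ⟨p, hp⟩ := exists_walkWeight_eq_wdist (w := w) (hP.parentGraph_connected u v)
  rw [← hp]
  refine le_walkWeight (cutDist_self w P) (cutDist_triangle w P) (fun a b hab => ?_) p
  obtain ⟨-, rfl | rfl⟩ := parentGraph_adj.1 hab
  · exact cutDist_parent_le w P a
  · rw [cutDist_comm, Sym2.eq_swap]
    exact cutDist_parent_le w P b

theorem wdist_parentGraph (hP : IsRooted P r) (u v : V) :
    wdist (parentGraph P) w u v = cutDist w P u v :=
  le_antisymm (hP.wdist_le_cutDist u v) (hP.cutDist_le_wdist u v)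

end IsRooted

/-! ## Routing costs of rooted trees -/

open Classical in
/-- The number `z(u)` of vertices of `S` in the subtree below `u`. -/
def subtreeCount (S : Finset V) (P : V → V) (u : V) : ℕ :=
  ∑ y ∈ descendants P u, if y ∈ S then 1 else 0

/-- Half of the contribution of the edge between `x` and its parent to the routing cost. -/
def edgeCost (w : Sym2 V → ℕ) (S : Finset V) (P : V → V) (x : V) : ℕ :=
  w s(x, P x) * subtreeCount S P x * (S.card - subtreeCount S P x)

/-- The value `rc(u)`: half of the routing cost that is due to the edges of the subtree
below `u`. -/
def subtreeRoutingCost (w : Sym2 V → ℕ) (S : Finset V) (P : V → V) (u : V) : ℕ :=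
  ∑ c ∈ childrenOf P u, ∑ y ∈ descendants P c, edgeCost w S P y

open Classical in
theorem subtreeCount_eq_card_filter (S : Finset V) (P : V → V) (u : V) :
    subtreeCount S P u = (S.filter (· ∈ descendants P u)).card := by
  rw [subtreeCount, Finset.sum_boole, Finset.filter_mem_eq_inter, Finset.filter_mem_eq_inter,
    Finset.inter_comm, Nat.cast_id]

theorem subtreeCount_le (S : Finset V) (P : V → V) (u : V) : subtreeCount S P u ≤ S.card := by
  classical
  exact (subtreeCount_eq_card_filter S P u).trans_le (Finset.card_filter_le _ _)

theorem sum_sum_ite_iff {α : Type*} (S : Finset α) (p : α → Prop) [DecidablePred p] (c : ℕ) :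
    ∑ u ∈ S, ∑ v ∈ S, (if p u ↔ p v then 0 else c) =
      2 * (c * (S.filter p).card * (S.card - (S.filter p).card)) := by
  have hcompl : S.card - (S.filter p).card = (S.filter (¬ p ·)).card := by
    have := Finset.card_filter_add_card_filter_not (s := S) p
    omega
  have hrow (u : α) : ∑ v ∈ S, (if p u ↔ p v then 0 else c) =
      if p u then (S.filter (¬ p ·)).card * c else (S.filter p).card * c := by
    by_cases hu : p u <;> simp [hu, Finset.sum_ite]
  simp only [hrow, Finset.sum_ite, Finset.sum_const, smul_eq_mul, hcompl]
  ring

namespace IsRooted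

open Classical in
theorem subtreeCount_rec (hP : IsRooted P r) (S : Finset V) (u : V) :
    subtreeCount S P u = (if u ∈ S then 1 else 0) + ∑ c ∈ childrenOf P u, subtreeCount S P c :=
  hP.sum_descendants _ u

theorem subtreeCount_root (hP : IsRooted P r) (S : Finset V) : subtreeCount S P r = S.card := by
  simp [subtreeCount, hP.descendants_root]

theorem sum_descendants_edgeCost (hP : IsRooted P r) (w : Sym2 V → ℕ) (S : Finset V) (u : V) :
    ∑ y ∈ descendants P u, edgeCost w S P y = edgeCost w S P u + subtreeRoutingCost w S P u :=
  hP.sum_descendants _ u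

theorem subtreeRoutingCost_rec (hP : IsRooted P r) (w : Sym2 V → ℕ) (S : Finset V) (u : V) :
    subtreeRoutingCost w S P u =
      ∑ c ∈ childrenOf P u, (subtreeRoutingCost w S P c +
        w s(u, c) * subtreeCount S P c * (S.card - subtreeCount S P c)) := by
  refine Finset.sum_congr rfl fun c hc => ?_
  rw [hP.sum_descendants_edgeCost, add_comm, edgeCost, (mem_childrenOf.1 hc).2, Sym2.eq_swap]

theorem subtreeRoutingCost_root (hP : IsRooted P r) (w : Sym2 V → ℕ) (S : Finset V) :
    subtreeRoutingCost w S P r = ∑ x, edgeCost w S P x := by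
  have hroot : edgeCost w S P r = 0 := by simp [edgeCost, hP.subtreeCount_root]
  rw [← hP.descendants_root, hP.sum_descendants_edgeCost, hroot, zero_add]

theorem subtreeRoutingCost_le_root (hP : IsRooted P r) (w : Sym2 V → ℕ) (S : Finset V) (u : V) :
    subtreeRoutingCost w S P u ≤ subtreeRoutingCost w S P r :=
  calc subtreeRoutingCost w S P u ≤ ∑ y ∈ descendants P u, edgeCost w S P y :=
        (Nat.le_add_left _ _).trans_eq (hP.sum_descendants_edgeCost w S u).symm
    _ ≤ ∑ y, edgeCost w S P y := Finset.sum_le_sum_of_subset (Finset.subset_univ _)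
    _ = subtreeRoutingCost w S P r := (hP.subtreeRoutingCost_root w S).symm

theorem two_mul_subtreeRoutingCost_root (hP : IsRooted P r) (w : Sym2 V → ℕ) (S : Finset V) :
    2 * subtreeRoutingCost w S P r = ∑ u ∈ S, ∑ v ∈ S, wdist (parentGraph P) w u v := by
  classical
  calc 2 * subtreeRoutingCost w S P r = ∑ x, 2 * edgeCost w S P x := by
        rw [hP.subtreeRoutingCost_root, Finset.mul_sum]
    _ = ∑ x, ∑ u ∈ S, ∑ v ∈ S,
          if u ∈ descendants P x ↔ v ∈ descendants P x then 0 else w s(x, P x) :=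
        Finset.sum_congr rfl fun x _ => by
          rw [sum_sum_ite_iff, ← subtreeCount_eq_card_filter, edgeCost]
    _ = ∑ u ∈ S, ∑ v ∈ S, cutDist w P u v := by
        rw [Finset.sum_comm]
        refine Finset.sum_congr rfl fun u _ => ?_
        rw [Finset.sum_comm]
        refine Finset.sum_congr rfl fun v _ => ?_
        rw [cutDist]
    _ = ∑ u ∈ S, ∑ v ∈ S, wdist (parentGraph P) w u v := by simp only [hP.wdist_parentGraph]

end IsRooted

end RootedTrees

/-! ## Shortest-path trees -/

section ShortestPathTrees

variable {V : Type} {G : SimpleGraph V} {w : Sym2 V → ℕ} {r : V}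

/-- Parent maps of shortest-path trees: `P` sends every vertex other than `r` to a neighbor
that precedes it on a shortest path from `r`. -/
structure IsShortestPathMap (G : SimpleGraph V) (w : Sym2 V → ℕ) (r : V) (P : V → V) : Prop where
  root : P r = r
  adj : ∀ u, u ≠ r → G.Adj u (P u)
  dist : ∀ u, u ≠ r → wdist G w r (P u) + w s(u, P u) = wdist G w r u

namespace IsShortestPathMap

variable {P : V → V}

theorem isRooted (hP : IsShortestPathMap G w r P) (hw : ∀ e ∈ G.edgeSet, 0 < w e) :
    IsRooted P r where
  root := hP.root
  reaches u := by
    induction hd : wdist G w r u using Nat.strong_induction_on generalizing u with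
    | _ d ih =>
      by_cases hu : u = r
      · exact ⟨0, hu⟩
      · have hlt : wdist G w r (P u) < d := by
          have hpos := hw s(u, P u) (hP.adj u hu)
          have hdist := hP.dist u hu
          omega
        obtain ⟨k, hk⟩ := ih _ hlt (P u) rfl
        exact ⟨k + 1, hk⟩

theorem parentGraph_le (hP : IsShortestPathMap G w r P) : parentGraph P ≤ G := by
  have adj_of_ne {u : V} (hu : P u ≠ u) : G.Adj u (P u) :=
    hP.adj u fun h => hu (h ▸ hP.root)
  intro u v huv
  obtain ⟨hne, rfl | rfl⟩ := parentGraph_adj.1 huv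
  exacts [adj_of_ne hne.symm, (adj_of_ne hne).symm]

/-- The shortest-path tree with parent map `P`, as a subgraph of `G`. -/
def tree (hP : IsShortestPathMap G w r P) : G.Subgraph :=
  SimpleGraph.toSubgraph (parentGraph P) hP.parentGraph_le

theorem tree_adj (hP : IsShortestPathMap G w r P) {u v : V} :
    hP.tree.Adj u v ↔ u ≠ v ∧ (P u = v ∨ P v = u) :=
  parentGraph_adj

theorem wdist_parentGraph_le (hP : IsShortestPathMap G w r P) (hw : ∀ e ∈ G.edgeSet, 0 < w e)
    (u : V) : wdist (parentGraph P) w u r ≤ wdist G w r u := by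
  have hrooted := hP.isRooted hw
  obtain ⟨k, hk⟩ := hrooted.reaches u
  induction k generalizing u with
  | zero =>
    obtain rfl : u = r := hk
    exact (wdist_self u).trans_le (Nat.zero_le _)
  | succ k ih =>
    by_cases hu : u = r
    · subst hu
      exact (wdist_self u).trans_le (Nat.zero_le _)
    · calc wdist (parentGraph P) w u r ≤ w s(u, P u) + wdist (parentGraph P) w (P u) r :=
            wdist_le_weight_add_wdist hrooted.parentGraph_connected
              (hrooted.parentGraph_adj_parent hu) r
        _ ≤ w s(u, P u) + wdist G w r (P u) := Nat.add_le_add_left (ih (P u) hk) _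
        _ = wdist G w r u := by rw [add_comm, hP.dist u hu]

theorem isShortestPathTree [Finite V] (hP : IsShortestPathMap G w r P)
    (hw : ∀ e ∈ G.edgeSet, 0 < w e) : IsShortestPathTree G w r hP.tree := by
  have hrooted := hP.isRooted hw
  have hspan : hP.tree.IsSpanning := SimpleGraph.toSubgraph.isSpanning _ _
  refine ⟨hspan, (hP.tree.spanningCoeEquivCoeOfSpanning hspan).isTree_iff.1
    hrooted.parentGraph_isTree, fun u => le_antisymm ?_ ?_⟩
  · exact (wdist_comm r u).trans_le (hP.wdist_parentGraph_le hw u)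
  · exact wdist_anti hP.parentGraph_le (hrooted.parentGraph_connected r u)

theorem two_mul_subtreeRoutingCost [Fintype V] (hP : IsShortestPathMap G w r P)
    (hw : ∀ e ∈ G.edgeSet, 0 < w e) (S : Finset V) :
    2 * subtreeRoutingCost w S P r = routingCost w S hP.tree :=
  (hP.isRooted hw).two_mul_subtreeRoutingCost_root w S

end IsShortestPathMap

namespace IsShortestPathTree

variable {T : G.Subgraph}

theorem spansAsTree (h : IsShortestPathTree G w r T) (S : Finset V) : SpansAsTree G S T :=
  ⟨h.2.1, fun v _ => h.1 v⟩

theorem wdist_le (h : IsShortestPathTree G w r T) (u v : V) :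
    wdist T.spanningCoe w u v ≤ wdist G w r u + wdist G w r v := by
  have hconn : T.spanningCoe.Connected :=
    (T.spanningCoeEquivCoeOfSpanning h.1).connected_iff.2 h.2.1.connected
  calc wdist T.spanningCoe w u v ≤ wdist T.spanningCoe w u r + wdist T.spanningCoe w r v :=
        wdist_triangle hconn u r v
    _ = wdist G w r u + wdist G w r v := by rw [wdist_comm u r, h.2.2, h.2.2]

theorem routingCost_le (h : IsShortestPathTree G w r T) (S : Finset V) :
    routingCost w S T ≤ 2 * S.card * ∑ u ∈ S, wdist G w r u := by
  calc routingCost w S T ≤ ∑ u ∈ S, ∑ v ∈ S, (wdist G w r u + wdist G w r v) :=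
        Finset.sum_le_sum fun u _ => Finset.sum_le_sum fun v _ => h.wdist_le u v
    _ = 2 * S.card * ∑ u ∈ S, wdist G w r u := by
        simp only [Finset.sum_add_distrib, Finset.sum_const, smul_eq_mul, ← Finset.mul_sum]
        ring

end IsShortestPathTree

theorem SpansAsTree.wdist_le {S : Finset V} {T : G.Subgraph} (h : SpansAsTree G S T) {u v : V}
    (hu : u ∈ S) (hv : v ∈ S) : wdist G w u v ≤ wdist T.spanningCoe w u v :=
  wdist_anti (SimpleGraph.Subgraph.spanningCoe_le _)
    ((h.1.connected ⟨u, h.2 hu⟩ ⟨v, h.2 hv⟩).map T.coeEmbeddingSpanningCoe.toHom)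

theorem isMulApprox_of_forall_le {S : Finset V} (T : V → G.Subgraph)
    (hT : ∀ r ∈ S, IsShortestPathTree G w r (T r)) {best : V} (hbest : best ∈ S)
    (hle : ∀ r ∈ S, routingCost w S (T best) ≤ routingCost w S (T r)) :
    IsMulApprox 2 (optRoutingCost G w S) (routingCost w S (T best)) := by
  have hmem : routingCost w S (T best) ∈
      {c | ∃ T : G.Subgraph, SpansAsTree G S T ∧ c = routingCost w S T} :=
    ⟨_, (hT best hbest).spansAsTree S, rfl⟩
  refine ⟨Nat.sInf_le hmem, ?_⟩
  obtain ⟨T₀, hT₀, hopt⟩ : ∃ T₀ : G.Subgraph, SpansAsTree G S T₀ ∧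
      optRoutingCost G w S = routingCost w S T₀ := Nat.sInf_mem ⟨_, hmem⟩
  rw [hopt]
  refine Nat.le_of_mul_le_mul_left ?_ (Finset.card_pos.2 ⟨best, hbest⟩)
  calc S.card * routingCost w S (T best) = ∑ _r ∈ S, routingCost w S (T best) := by simp
    _ ≤ ∑ r ∈ S, 2 * S.card * ∑ u ∈ S, wdist G w r u :=
        Finset.sum_le_sum fun r hr => (hle r hr).trans ((hT r hr).routingCost_le S)
    _ = 2 * S.card * ∑ r ∈ S, ∑ u ∈ S, wdist G w r u := by rw [Finset.mul_sum]
    _ ≤ 2 * S.card * routingCost w S T₀ := Nat.mul_le_mul_left _ <|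
        Finset.sum_le_sum fun r hr => Finset.sum_le_sum fun u hu => hT₀.wdist_le hr hu
    _ = S.card * (2 * routingCost w S T₀) := by ring

end ShortestPathTrees

/-! ## Minimizers -/

section Argmin

variable {α β : Type*} [LinearOrder β] [WellFoundedLT β]

open Classical in
/-- An element of `K` at which `f` is minimal, if `K` is nonempty. -/
def argminOn? (f : α → β) (K : Set α) : Option α :=
  if hK : K.Nonempty then some (Function.argminOn f K hK) else none

variable {f : α → β} {K : Set α} {a : α}

theorem exists_argminOn?_eq_some (f : α → β) (hK : K.Nonempty) : ∃ a, argminOn? f K = some a :=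
  ⟨_, dif_pos hK⟩

theorem argminOn?_eq_none (f : α → β) (hK : ¬K.Nonempty) : argminOn? f K = none :=
  dif_neg hK

theorem argminOn?_mem (h : argminOn? f K = some a) : a ∈ K := by
  unfold argminOn? at h
  split_ifs at h with hK
  exact Option.some.inj h ▸ Function.argminOn_mem f K hK

theorem argminOn?_le (h : argminOn? f K = some a) {b : α} (hb : b ∈ K) : f a ≤ f b := by
  unfold argminOn? at h
  split_ifs at h with hK
  exact Option.some.inj h ▸ Function.argminOn_le f K hb

theorem argminOn?_eq_some_iff (hf : Function.Injective f) :
    argminOn? f K = some a ↔ a ∈ K ∧ ∀ b ∈ K, f a ≤ f b := by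
  refine ⟨fun h => ⟨argminOn?_mem h, fun _ => argminOn?_le h⟩, fun ⟨ha, hle⟩ => ?_⟩
  obtain ⟨b, hb⟩ := exists_argminOn?_eq_some f ⟨a, ha⟩
  rw [hb, hf (le_antisymm (argminOn?_le hb ha) (hle b (argminOn?_mem hb)))]

end Argmin

/-! ## Messages -/

section Encoding

variable {α β : Type*} [Encodable α] [Encodable β]

/-- The binary digits of the code of `a`, as a message. -/
def encodeMessage (a : α) : Message := (Encodable.encode a).bits

/-- Inverse of `encodeMessage`. -/
def decodeMessage (α : Type*) [Encodable α] (l : Message) : Option α :=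
  Encodable.decode (Nat.ofDigits 2 (l.map fun b => cond b 1 0))

theorem decodeMessage_encodeMessage (a : α) : decodeMessage α (encodeMessage a) = some a := by
  rw [decodeMessage, encodeMessage, ← Nat.digits_two_eq_bits, Nat.ofDigits_digits,
    Encodable.encodek]

theorem length_encodeMessage_le {a : α} {k : ℕ} (h : Encodable.encode a < 2 ^ k) :
    (encodeMessage a).length ≤ k := by
  rwa [encodeMessage, Nat.size_eq_bits_len, Nat.size_le]

theorem encode_option_lt_two_pow {x : Option α} {k : ℕ}
    (h : ∀ a, x = some a → Encodable.encode a < 2 ^ k) : Encodable.encode x < 2 ^ (k + 1) := by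
  cases x with
  | none => simp
  | some a =>
    have := h a rfl
    rw [Encodable.encode_some, pow_succ, Nat.succ_eq_add_one]
    omega

theorem encode_prod_lt_two_pow {a : α} {b : β} {i j n : ℕ} (ha : Encodable.encode a < 2 ^ i)
    (hb : Encodable.encode b < 2 ^ j) (hi : i ≤ n) (hj : j ≤ n) :
    Encodable.encode (a, b) < 2 ^ (2 * n) := by
  have hmax : max (Encodable.encode a) (Encodable.encode b) < 2 ^ n :=
    max_lt (ha.trans_le (Nat.pow_le_pow_right two_pos hi))
      (hb.trans_le (Nat.pow_le_pow_right two_pos hj))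
  calc Encodable.encode (a, b) < (max (Encodable.encode a) (Encodable.encode b) + 1) ^ 2 := by
        rw [Encodable.encode_prod_val]
        exact Nat.pair_lt_max_add_one_sq _ _
    _ ≤ 2 ^ (2 * n) := by
        rw [mul_comm, pow_mul]
        exact Nat.pow_le_pow_left hmax 2

end Encoding

/-- The contents of a message: an announcement `token` (distance, source), a number `count` of
finished nodes, the starting time of the second stage, a `report` (source, subtree size, subtree
cost), and the best source known, as a pair (cost, source). -/
structure Packet where
  token : Option (ℕ × ℕ)
  count : ℕ
  start : Option ℕ
  report : Option (ℕ × ℕ × ℕ)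
  best : Option (ℕ × ℕ)

namespace Packet

/-- A packet as the tuple of its fields. -/
def equivTuple :
    Packet ≃ Option (ℕ × ℕ) × ℕ × Option ℕ × Option (ℕ × ℕ × ℕ) × Option (ℕ × ℕ) where
  toFun m := (m.token, m.count, m.start, m.report, m.best)
  invFun x := ⟨x.1, x.2.1, x.2.2.1, x.2.2.2.1, x.2.2.2.2⟩
  left_inv _ := rfl
  right_inv _ := rfl

instance : Encodable Packet := Encodable.ofEquiv _ equivTuple

/-- All numbers in the packet have at most `k` binary digits. -/
structure Fits (m : Packet) (k : ℕ) : Prop where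
  token : ∀ p, m.token = some p → p.1 < 2 ^ k ∧ p.2 < 2 ^ k
  count : m.count < 2 ^ k
  start : ∀ b, m.start = some b → b < 2 ^ k
  report : ∀ p, m.report = some p → p.1 < 2 ^ k ∧ p.2.1 < 2 ^ k ∧ p.2.2 < 2 ^ k
  best : ∀ p, m.best = some p → p.1 < 2 ^ k ∧ p.2 < 2 ^ k

theorem Fits.length_encodeMessage_le {m : Packet} {k : ℕ} (h : m.Fits k) :
    (encodeMessage m).length ≤ 64 * k + 16 := by
  have pair_lt {x : Option (ℕ × ℕ)} (hx : ∀ p, x = some p → p.1 < 2 ^ k ∧ p.2 < 2 ^ k) :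
      Encodable.encode x < 2 ^ (2 * k + 1) :=
    encode_option_lt_two_pow fun p hp =>
      encode_prod_lt_two_pow (hx p hp).1 (hx p hp).2 le_rfl le_rfl
  have hstart : Encodable.encode m.start < 2 ^ (k + 1) := encode_option_lt_two_pow h.start
  have hreport : Encodable.encode m.report < 2 ^ (4 * k + 1) :=
    encode_option_lt_two_pow fun p hp => by
      obtain ⟨hsource, hsize, hcost⟩ := h.report p hp
      have htail : Encodable.encode p.2 < 2 ^ (2 * k) :=
        encode_prod_lt_two_pow hsize hcost le_rfl le_rfl
      have hp : Encodable.encode p < 2 ^ (2 * (2 * k)) :=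
        encode_prod_lt_two_pow hsource htail (by omega) le_rfl
      rwa [← mul_assoc] at hp
  have hcount : Encodable.encode m.count < 2 ^ k := h.count
  have hrest₁ := encode_prod_lt_two_pow hreport (pair_lt h.best) (n := 4 * k + 1) le_rfl (by omega)
  have hrest₂ := encode_prod_lt_two_pow hstart hrest₁ (n := 8 * k + 2) (by omega) (by omega)
  have hrest₃ := encode_prod_lt_two_pow hcount hrest₂ (n := 16 * k + 4) (by omega) (by omega)
  have hall := encode_prod_lt_two_pow (pair_lt h.token) hrest₃ (n := 32 * k + 8) (by omega)
    (by omega)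
  refine MRCT.length_encodeMessage_le (hall.trans_eq ?_)
  ring_nf

end Packet

/-! ## The algorithm -/

/-- The state of a node: its input, the number of elapsed rounds, the set of all packets received
so far together with the identifiers of their senders, and the common starting time of the second
stage, once known. -/
structure NodeState where
  input : LocalInput
  time : ℕ
  inbox : Set (ℕ × Packet)
  started : Option ℕ

namespace NodeState

variable (s : NodeState)

/-- The upper bounds on the distance to the source `j`, each with the identifier of the neighbor
that it comes from; a source offers itself the distance `0` under its own identifier. -/
def offers (j : ℕ) : Set (ℕ × ℕ) :=
  {p | (s.input.inS ∧ j = s.input.ident ∧ p = (0, j)) ∨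
    ∃ w d m, (p.2, w) ∈ s.input.links ∧ (p.2, m) ∈ s.inbox ∧ m.token = some (d, j) ∧
      p.1 = d + w}

/-- The best offer for the source `j`: an estimate of the distance, and where it comes from. -/
def route (j : ℕ) : Option (ℕ × ℕ) := argminOn? toLex (s.offers j)

/-- The sources that the node has heard of. -/
def sources : Set ℕ := {j | ∃ p, s.route j = some p}

/-- The number of sources that, as far as the node knows, precede the source `j` at
distance `d`. -/
def rank (d j : ℕ) : ℕ :=
  Set.ncard {i | ∃ p, s.route i = some p ∧ toLex (p.1, i) < toLex (d, j)}

/-- The round in which the node announces its distance `d` from the source `j`, as far as it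
knows. -/
def slot (d j : ℕ) : ℕ := d + s.rank d j

/-- The distance that is announced in the current round, as a pair (distance, source). -/
def token : Option (ℕ × ℕ) :=
  argminOn? toLex {q | ∃ i, s.route q.2 = some (q.1, i) ∧ s.slot q.1 q.2 = s.time}

/-- The node has heard of all sources, and all its announcements are due. -/
def complete : Prop :=
  s.sources.ncard = s.input.sizeS ∧ ∀ j d i, s.route j = some (d, i) → s.slot d j ≤ s.time

/-- The smallest source. -/
def leader : ℕ := sInf s.sources

/-- The largest number of complete nodes that the neighbor `i` has reported. -/
def childCount (i : ℕ) : ℕ := sSup {c | ∃ m, (i, m) ∈ s.inbox ∧ m.count = c}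

open Classical in
/-- The number of complete nodes in the subtree of the leader's tree, as far as known. -/
def counted : ℕ :=
  if s.complete then
    1 + ∑ l ∈ s.input.links, s.childCount l.1
  else 0

/-- The node is the leader and knows that all nodes are complete. -/
def ready : Prop := s.complete ∧ s.leader = s.input.ident ∧ s.counted = s.input.numNodes

/-- The possible starting times of the second stage: when the leader becomes ready, it proposes
the current round. -/
def startCandidates : Set ℕ :=
  {b | s.started = some b ∨ (∃ i m, (i, m) ∈ s.inbox ∧ m.start = some b) ∨
    (s.ready ∧ b = s.time)}

/-- The starting time of the second stage, if it is known. -/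
def startTime : Option ℕ := argminOn? id s.startCandidates

/-- The subtree size and subtree cost reported by the neighbor `i` for the root `j`; both are `0`
if there is no report. -/
def childReport (j i : ℕ) : ℕ × ℕ :=
  (argminOn? toLex {p : ℕ × ℕ | ∃ m, (i, m) ∈ s.inbox ∧ m.report = some (j, p)}).getD (0, 0)

open Classical in
/-- The number of nodes of `S` in the subtree of the tree with root `j`. -/
def size (j : ℕ) : ℕ :=
  (if s.input.inS then 1 else 0) + ∑ l ∈ s.input.links, (s.childReport j l.1).1

/-- The routing cost of the subtree of the tree with root `j`. -/
def cost (j : ℕ) : ℕ :=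
  ∑ l ∈ s.input.links, ((s.childReport j l.1).2 +
    l.2 * (s.childReport j l.1).1 * (s.input.sizeS - (s.childReport j l.1).1))

/-- The identifier of the parent in the tree with root `j`; the root itself has none. -/
def parent (j : ℕ) : Option ℕ :=
  (s.route j).bind fun p => if p.2 = s.input.ident then none else some p.2

/-- The roots for which a report to the parent `i` is due in the current round: the reports
travel in the reverse order of the announcements. -/
def due (i : ℕ) : Set ℕ :=
  {j | s.parent j = some i ∧ ∃ b d k, s.startTime = some b ∧ s.route j = some (d, k) ∧
    s.time + s.slot d j = 3 * b}

/-- The report that is sent to the neighbor `i` in the current round. -/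
def report (i : ℕ) : Option (ℕ × ℕ × ℕ) :=
  (argminOn? id (s.due i)).map fun j => (j, s.size j, s.cost j)

/-- The roots that the node knows, as pairs (cost, root); a source knows its own cost when all
reports have arrived. -/
def bestCandidates : Set (ℕ × ℕ) :=
  {p | (∃ i m, (i, m) ∈ s.inbox ∧ m.best = some p) ∨
    (s.input.inS ∧ p = (s.cost s.input.ident, s.input.ident) ∧
      ∃ b, s.startTime = some b ∧ 3 * b ≤ s.time)}

/-- The cheapest root that the node knows. -/
def best : Option (ℕ × ℕ) := argminOn? toLex s.bestCandidates

open Classical in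
/-- The packet that is sent to the neighbor `i` in the current round. -/
def packet (i : ℕ) : Packet where
  token := s.token
  count := if s.complete ∧ s.parent s.leader = some i then s.counted else 0
  start := s.startTime
  report := s.report i
  best := s.best

/-- The final values of the variables of the node. -/
def result : Result where
  parent := s.parent
  dist j := ((s.route j).getD (0, 0)).1
  subtreeSize j := if (s.route j).isSome then s.size j else 0
  subtreeCost j := if (s.route j).isSome then s.cost j else 0
  best := (s.best.getD (0, 0)).2

end NodeState

open Classical in
/-- The algorithm.  In the first stage, every node announces its distances from the sources in
the order of their distances, and the leader counts the nodes that know all their distances.  The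
time at which it has counted all of them is the starting time of the second stage.  In that stage,
the subtree costs travel towards the roots in the reverse order, after which the cheapest root is
determined. -/
def mrct : Algorithm Result where
  State := NodeState
  init I := ⟨I, 0, ∅, none⟩
  send s i := some (encodeMessage (s.packet i))
  step s rcv :=
    { input := s.input
      time := s.time + 1
      inbox := s.inbox ∪ {x | ∃ l, rcv x.1 = some l ∧ decodeMessage Packet l = some x.2}
      started := s.startTime }
  output s := if ∃ b, s.startTime = some b ∧ 4 * b ≤ s.time then some s.result else none

/-! ## Executions -/

namespace Network

section Setup

variable {V : Type} [Fintype V] (N : Network V) (S : Finset V)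

/-- The state of node `u` after `t` rounds of the algorithm. -/
def state (t : ℕ) (u : V) : NodeState := N.run S mrct t u

/-- Weighted distance in the network. -/
def dist (r u : V) : ℕ := wdist N.graph N.weight r u

/-- No message needs more rounds than the weight of the edge it travels through. -/
def LatencyLeWeight : Prop :=
  ∀ ⦃u v⦄, N.graph.Adj u v → N.latency s(u, v) ≤ N.weight s(u, v)

theorem latency_pos_of_adj {u v : V} (h : N.graph.Adj u v) : 0 < N.latency s(u, v) :=
  N.latency_pos _ h

theorem weight_pos_of_adj {u v : V} (h : N.graph.Adj u v) : 0 < N.weight s(u, v) :=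
  N.weight_pos _ h

theorem neighbor_eq_some {u v : V} {i : ℕ} :
    N.neighbor u i = some v ↔ N.graph.Adj u v ∧ N.ident v = i := by
  unfold neighbor
  split_ifs with h
  · refine ⟨fun hv => Option.some.inj hv ▸ h.choose_spec, fun hv => congrArg some ?_⟩
    exact N.ident_injective (h.choose_spec.2.trans hv.2.symm)
  · exact ⟨nofun, fun hv => (h ⟨v, hv⟩).elim⟩

theorem state_zero (u : V) : N.state S 0 u = ⟨N.localInput S u, 0, ∅, none⟩ := by
  rw [state, run]
  rfl

theorem state_succ (t : ℕ) (u : V) :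
    N.state S (t + 1) u =
      { input := (N.state S t u).input
        time := (N.state S t u).time + 1
        inbox := (N.state S t u).inbox ∪ {x | ∃ v, N.graph.Adj u v ∧ N.ident v = x.1 ∧
          N.latency s(u, v) ≤ t + 1 ∧
          (N.state S (t + 1 - N.latency s(u, v)) v).packet (N.ident u) = x.2}
        started := (N.state S t u).startTime } := by
  rw [state, run]
  change NodeState.mk _ _ _ _ = NodeState.mk _ _ _ _
  congr 2
  ext ⟨i, m⟩
  simp only [Set.mem_ofPred_eq, Option.bind_eq_some_iff, neighbor_eq_some]
  constructor
  · rintro ⟨l, ⟨v, ⟨hadj, hi⟩, hl⟩, hm⟩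
    split_ifs at hl with h
    obtain rfl := Option.some.inj hl
    exact ⟨v, hadj, hi, h.2, Option.some.inj ((decodeMessage_encodeMessage _).symm.trans hm)⟩
  · rintro ⟨v, hadj, hi, hlat, rfl⟩
    exact ⟨_, ⟨v, ⟨hadj, hi⟩, dif_pos ⟨N.latency_pos_of_adj hadj, hlat⟩⟩,
      decodeMessage_encodeMessage _⟩

@[simp]
theorem state_input (t : ℕ) (u : V) : (N.state S t u).input = N.localInput S u := by
  induction t with
  | zero => rw [state_zero]
  | succ t ih => rw [state_succ, ih]

@[simp]
theorem state_time (t : ℕ) (u : V) : (N.state S t u).time = t := by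
  induction t with
  | zero => rw [state_zero]
  | succ t ih => rw [state_succ, ih]

theorem state_started_succ (t : ℕ) (u : V) :
    (N.state S (t + 1) u).started = (N.state S t u).startTime := by
  rw [state_succ]

theorem mem_inbox {t : ℕ} {u : V} {i : ℕ} {m : Packet} :
    (i, m) ∈ (N.state S t u).inbox ↔ ∃ v s, N.graph.Adj u v ∧ N.ident v = i ∧
      s + N.latency s(u, v) ≤ t ∧ (N.state S s v).packet (N.ident u) = m := by
  induction t with
  | zero =>
    rw [state_zero]
    refine ⟨nofun, ?_⟩
    rintro ⟨v, s, hadj, -, hle, -⟩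
    have := N.latency_pos_of_adj hadj
    omega
  | succ t ih =>
    rw [state_succ, Set.mem_union, ih]
    constructor
    · rintro (⟨v, s, hadj, hi, hle, hm⟩ | ⟨v, hadj, hi, hle, hm⟩)
      · exact ⟨v, s, hadj, hi, by omega, hm⟩
      · exact ⟨v, _, hadj, hi, by omega, hm⟩
    · rintro ⟨v, s, hadj, hi, hle, hm⟩
      rcases hle.lt_or_eq with h | h
      · exact Or.inl ⟨v, s, hadj, hi, by omega, hm⟩
      · exact Or.inr ⟨v, hadj, hi, by omega, by rwa [← h, Nat.add_sub_cancel]⟩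

theorem mem_inbox_ident {t : ℕ} {u v : V} {m : Packet} (hadj : N.graph.Adj u v) :
    (N.ident v, m) ∈ (N.state S t u).inbox ↔
      ∃ s, s + N.latency s(u, v) ≤ t ∧ (N.state S s v).packet (N.ident u) = m := by
  rw [mem_inbox]
  refine ⟨fun ⟨v', s, _, hi, h⟩ => ?_, fun ⟨s, h⟩ => ⟨v, s, hadj, rfl, h⟩⟩
  obtain rfl := N.ident_injective hi
  exact ⟨s, h⟩

theorem mem_links {u : V} {i w : ℕ} :
    (i, w) ∈ (N.localInput S u).links ↔
      ∃ v, N.graph.Adj u v ∧ N.ident v = i ∧ N.weight s(u, v) = w := by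
  simp [localInput]

/-! ### Shortest-path trees and the schedule -/

theorem dist_le_add_weight (r : V) {u v : V} (h : N.graph.Adj u v) :
    N.dist r u ≤ N.dist r v + N.weight s(u, v) := by
  simpa only [dist, wdist_comm r, add_comm] using
    wdist_le_weight_add_wdist (w := N.weight) N.connected h r

theorem dist_le_diam (u v : V) : N.dist u v ≤ N.diam :=
  (Finset.le_sup (f := fun v => wdist N.graph N.weight u v) (Finset.mem_univ v)).trans
    (Finset.le_sup (f := fun u => Finset.univ.sup fun v => wdist N.graph N.weight u v)
      (Finset.mem_univ u))

/-- The edge from `u` to `v` is the first edge of a shortest path from `u` to `r`. -/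
def IsTight (r u v : V) : Prop :=
  N.graph.Adj u v ∧ N.dist r v + N.weight s(u, v) = N.dist r u

theorem exists_isTight {r u : V} (h : u ≠ r) : ∃ v, N.IsTight r u v :=
  exists_adj_wdist_add_weight N.connected h

theorem not_isTight_self (r v : V) : ¬ N.IsTight r r v := by
  rintro ⟨hadj, hdist⟩
  have := N.weight_pos_of_adj hadj
  rw [show N.dist r r = 0 from wdist_self r] at hdist
  omega

/-- The parent of `u` in the shortest-path tree with root `r` that the algorithm selects: the tight
neighbor with the smallest identifier, and `r` itself for `u = r`. -/
def parentOf (r u : V) : V := (argminOn? N.ident {v | N.IsTight r u v}).getD u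

theorem parentOf_eq_iff {r u v : V} (h : u ≠ r) :
    N.parentOf r u = v ↔ N.IsTight r u v ∧ ∀ v', N.IsTight r u v' → N.ident v ≤ N.ident v' := by
  obtain ⟨p, hp⟩ := exists_argminOn?_eq_some N.ident (K := {v | N.IsTight r u v})
    (N.exists_isTight h)
  rw [parentOf, hp, Option.getD_some, ← Option.some_inj, ← hp,
    argminOn?_eq_some_iff N.ident_injective]
  rfl

theorem isTight_parentOf {r u : V} (h : u ≠ r) : N.IsTight r u (N.parentOf r u) :=
  ((N.parentOf_eq_iff h).1 rfl).1

theorem isShortestPathMap (r : V) :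
    IsShortestPathMap N.graph N.weight r (N.parentOf r) where
  root := by
    have hnone : argminOn? N.ident {v | N.IsTight r r v} = none :=
      argminOn?_eq_none N.ident fun ⟨v, hv⟩ => N.not_isTight_self r v hv
    rw [parentOf, hnone, Option.getD_none]
  adj _ h := (N.isTight_parentOf h).1
  dist _ h := (N.isTight_parentOf h).2

theorem isRooted_parentOf (r : V) : IsRooted (N.parentOf r) r :=
  (N.isShortestPathMap r).isRooted N.weight_pos

theorem isTight_of_mem_childrenOf {r u c : V} (h : c ∈ childrenOf (N.parentOf r) u) :
    N.IsTight r c u := by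
  obtain ⟨hne, rfl⟩ := mem_childrenOf.1 h
  refine N.isTight_parentOf fun hc => hne ?_
  rw [hc, (N.isShortestPathMap r).root]

theorem sum_links_eq_sum_childrenOf {r u : V} {f : ℕ × ℕ → ℕ}
    (hf : ∀ v, N.graph.Adj u v → v ∉ childrenOf (N.parentOf r) u →
      f (N.ident v, N.weight s(u, v)) = 0) :
    ∑ l ∈ (N.localInput S u).links, f l =
      ∑ c ∈ childrenOf (N.parentOf r) u, f (N.ident c, N.weight s(u, c)) := by
  classical
  have hinj : Function.Injective fun v => (N.ident v, N.weight s(u, v)) :=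
    fun _ _ h => N.ident_injective (Prod.mk.inj h).1
  rw [localInput, Finset.sum_image hinj.injOn]
  refine (Finset.sum_subset (fun c hc => ?_) fun v hv => ?_).symm
  · exact Finset.mem_filter.2 ⟨Finset.mem_univ c, (N.isTight_of_mem_childrenOf hc).1.symm⟩
  · exact hf v (Finset.mem_filter.1 hv).2

/-- The order in which the sources `r` are announced by the node `u`. -/
def key (u r : V) : ℕ ×ₗ ℕ := toLex (N.dist r u, N.ident r)

theorem key_injective (u : V) : Function.Injective (N.key u) :=
  fun _ _ h => N.ident_injective (Prod.mk.inj (toLex.injective h)).2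

theorem key_lt_key_of_isTight {r x u v : V} (h : N.IsTight r u v) (hx : N.key v x < N.key v r) :
    N.key u x < N.key u r := by
  have := N.dist_le_add_weight x h.1
  have := h.2
  rw [key, key, Prod.Lex.toLex_lt_toLex] at hx ⊢
  omega

/-- The number of sources that precede `r` at the node `u`. -/
def sourceRank (r u : V) : ℕ := (S.filter fun x => N.key u x < N.key u r).card

/-- The round in which the node `u` announces its distance from `r`. -/
def slot (r u : V) : ℕ := N.dist r u + N.sourceRank S r u

variable {S}

theorem dist_le_slot (r u : V) : N.dist r u ≤ N.slot S r u := Nat.le_add_right _ _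

theorem slot_lt_slot {u r r' : V} (hr' : r' ∈ S) (h : N.key u r' < N.key u r) :
    N.slot S r' u < N.slot S r u := by
  have hdist : N.dist r' u ≤ N.dist r u := by
    rw [key, key, Prod.Lex.toLex_lt_toLex] at h
    omega
  have hrank : N.sourceRank S r' u < N.sourceRank S r u :=
    Finset.card_lt_card <| Finset.ssubset_iff_of_subset
      (Finset.monotone_filter_right S fun x _ hx => hx.trans h) |>.2
      ⟨r', Finset.mem_filter.2 ⟨hr', h⟩, fun hx => lt_irrefl _ (Finset.mem_filter.1 hx).2⟩
  exact add_lt_add_of_le_of_lt hdist hrank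

theorem slot_injOn (u : V) : Set.InjOn (fun r => N.slot S r u) S := by
  intro r hr r' hr' h
  by_contra hne
  rcases ((N.key_injective u).ne hne).lt_or_gt with hlt | hlt
  · exact (N.slot_lt_slot hr hlt).ne h
  · exact (N.slot_lt_slot hr' hlt).ne' h

theorem slot_lt {r : V} (hr : r ∈ S) (u : V) : N.slot S r u < N.diam + S.card :=
  add_lt_add_of_le_of_lt (N.dist_le_diam r u) <|
    Finset.card_lt_card (Finset.filter_ssubset.2 ⟨r, hr, lt_irrefl _⟩)

theorem slot_add_weight_le {r u v : V} (h : N.IsTight r u v) :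
    N.slot S r v + N.weight s(u, v) ≤ N.slot S r u := by
  have hrank : N.sourceRank S r v ≤ N.sourceRank S r u :=
    Finset.card_le_card (Finset.monotone_filter_right S fun _ _ => N.key_lt_key_of_isTight h)
  have := h.2
  unfold slot
  omega

end Setup

/-! ### Announcement of distances -/

section Tokens

variable {V : Type} [Fintype V] {N : Network V} {S : Finset V}

/-- In round `t`, exactly the right distances are announced. -/
def TokensCorrect (N : Network V) (S : Finset V) (t : ℕ) : Prop :=
  ∀ u q, (N.state S t u).token = some q ↔
    ∃ r ∈ S, q = (N.dist r u, N.ident r) ∧ N.slot S r u = t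

theorem mem_offers {t : ℕ} (h : ∀ s < t, N.TokensCorrect S s) {u : V} {j : ℕ} {p : ℕ × ℕ} :
    p ∈ (N.state S t u).offers j ↔ (u ∈ S ∧ j = N.ident u ∧ p = (0, j)) ∨
      ∃ v, N.graph.Adj u v ∧ ∃ r ∈ S, j = N.ident r ∧ N.slot S r v + N.latency s(u, v) ≤ t ∧
        p = (N.dist r v + N.weight s(u, v), N.ident v) := by
  rw [NodeState.offers, Set.mem_ofPred_eq, state_input]
  refine or_congr Iff.rfl ?_
  obtain ⟨x, y⟩ := p
  constructor
  · rintro ⟨w, d, m, hl, hm, htok, rfl⟩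
    obtain ⟨v, hadj, rfl, rfl⟩ := (N.mem_links S).1 hl
    obtain ⟨s, hs, rfl⟩ := (N.mem_inbox_ident S hadj).1 hm
    have := N.latency_pos_of_adj hadj
    obtain ⟨r, hr, hq, rfl⟩ := (h s (by omega) v _).1 htok
    obtain ⟨rfl, rfl⟩ := Prod.mk.inj hq
    exact ⟨v, hadj, r, hr, rfl, hs, rfl⟩
  · rintro ⟨v, hadj, r, hr, rfl, hs, hp⟩
    obtain ⟨rfl, rfl⟩ := Prod.mk.inj hp
    have := N.latency_pos_of_adj hadj
    exact ⟨_, _, _, (N.mem_links S).2 ⟨v, hadj, rfl, rfl⟩,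
      (N.mem_inbox_ident S hadj).2 ⟨_, hs, rfl⟩, (h _ (by omega) v _).2 ⟨r, hr, rfl, rfl⟩, rfl⟩

/-- The routes known to `u` at time `t` are correct if they are due, and never too short. -/
structure RoutesCorrect (N : Network V) (S : Finset V) (t : ℕ) (u : V) : Prop where
  route_eq : ∀ r ∈ S, N.slot S r u ≤ t →
    (N.state S t u).route (N.ident r) = some (N.dist r u, N.ident (N.parentOf r u))
  of_route : ∀ j p, (N.state S t u).route j = some p →
    ∃ r ∈ S, j = N.ident r ∧ N.dist r u ≤ p.1

theorem isLeast_offers (hlat : N.LatencyLeWeight) {t : ℕ} (h : ∀ s < t, N.TokensCorrect S s)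
    {r u : V} (hr : r ∈ S) (hslot : N.slot S r u ≤ t) :
    (N.dist r u, N.ident (N.parentOf r u)) ∈ (N.state S t u).offers (N.ident r) ∧
      ∀ p ∈ (N.state S t u).offers (N.ident r),
        toLex (N.dist r u, N.ident (N.parentOf r u)) ≤ toLex p := by
  by_cases hu : u = r
  · subst hu
    rw [show N.dist u u = 0 from wdist_self u, (N.isShortestPathMap u).root]
    refine ⟨(mem_offers h).2 (Or.inl ⟨hr, rfl, rfl⟩), fun p hp => ?_⟩
    rw [Prod.Lex.toLex_le_toLex]
    rcases (mem_offers h).1 hp with ⟨-, -, rfl⟩ | ⟨v, hadj, r, -, -, -, rfl⟩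
    · exact Or.inr ⟨rfl, le_rfl⟩
    · exact Or.inl (Nat.add_pos_right _ (N.weight_pos_of_adj hadj))
  · obtain ⟨htight, hmin⟩ := (N.parentOf_eq_iff hu).1 rfl
    have := N.slot_add_weight_le (S := S) htight
    have := hlat htight.1
    refine ⟨(mem_offers h).2 (Or.inr ⟨_, htight.1, r, hr, rfl, by omega, by rw [htight.2]⟩),
      fun p hp => ?_⟩
    rw [Prod.Lex.toLex_le_toLex]
    rcases (mem_offers h).1 hp with ⟨-, hj, -⟩ | ⟨v, hadj, r', -, hj, -, rfl⟩
    · exact (hu (N.ident_injective hj).symm).elim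
    · obtain rfl := N.ident_injective hj
      exact (N.dist_le_add_weight r hadj).lt_or_eq.imp_right
        fun hd => ⟨hd, hmin v ⟨hadj, hd.symm⟩⟩

theorem routesCorrect_of_tokensCorrect (hlat : N.LatencyLeWeight)
    {t : ℕ} (h : ∀ s < t, N.TokensCorrect S s) (u : V) : N.RoutesCorrect S t u where
  route_eq _ hr hslot :=
    (argminOn?_eq_some_iff toLex.injective).2 (isLeast_offers hlat h hr hslot)
  of_route j p hp := by
    rcases (mem_offers h).1 (argminOn?_mem hp) with ⟨hu, hj, rfl⟩ | ⟨v, hadj, r, hr, hj, -, rfl⟩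
    · exact ⟨u, hu, hj, (wdist_self u).le⟩
    · exact ⟨r, hr, hj, N.dist_le_add_weight r hadj⟩

namespace RoutesCorrect

variable {t : ℕ} {u r : V} {p : ℕ × ℕ} {d j : ℕ}

theorem sources_subset (h : N.RoutesCorrect S t u) : (N.state S t u).sources ⊆ N.ident '' S := by
  rintro j ⟨p, hp⟩
  obtain ⟨r, hr, rfl, -⟩ := h.of_route j p hp
  exact Set.mem_image_of_mem _ hr

theorem rank_le_sourceRank (h : N.RoutesCorrect S t u) (r : V) :
    (N.state S t u).rank (N.dist r u) (N.ident r) ≤ N.sourceRank S r u := by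
  rw [sourceRank, ← Finset.card_image_of_injective _ N.ident_injective, ← Set.ncard_coe_finset]
  refine Set.ncard_le_ncard ?_ (Finset.finite_toSet _)
  rintro i ⟨p, hp, hlt⟩
  obtain ⟨x, hx, rfl, hle⟩ := h.of_route i p hp
  refine Finset.mem_coe.2 (Finset.mem_image_of_mem _ (Finset.mem_filter.2 ⟨hx, hlt.trans_le' ?_⟩))
  rw [key, Prod.Lex.toLex_le_toLex]
  exact hle.lt_or_eq.imp_right fun hd => ⟨hd, le_rfl⟩

theorem sourceRank_le_rank (h : N.RoutesCorrect S t u)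
    (hslot : ∀ x ∈ S, N.key u x < N.key u r → N.slot S x u ≤ t)
    (hle : N.key u r ≤ toLex (d, j)) : N.sourceRank S r u ≤ (N.state S t u).rank d j := by
  rw [sourceRank, ← Finset.card_image_of_injective _ N.ident_injective, ← Set.ncard_coe_finset]
  refine Set.ncard_le_ncard ?_
    (.subset (S.finite_toSet.image N.ident) fun i ⟨p, hp, _⟩ => h.sources_subset ⟨p, hp⟩)
  intro i hi
  obtain ⟨x, hx, rfl⟩ := Finset.mem_image.1 (Finset.mem_coe.1 hi)
  obtain ⟨hxS, hlt⟩ := Finset.mem_filter.1 hx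
  exact ⟨_, h.route_eq x hxS (hslot x hxS hlt), hlt.trans_le hle⟩

theorem slot_eq (h : N.RoutesCorrect S t u) (hslot : N.slot S r u ≤ t) :
    (N.state S t u).slot (N.dist r u) (N.ident r) = N.slot S r u :=
  congrArg (N.dist r u + ·) <| (h.rank_le_sourceRank r).antisymm <|
    h.sourceRank_le_rank (fun _ hx hlt => ((N.slot_lt_slot hx hlt).trans_le hslot).le) le_rfl

theorem lt_slot (h : N.RoutesCorrect S t u) (hr : r ∈ S) (hslot : t < N.slot S r u)
    (hd : N.dist r u ≤ d) : t < (N.state S t u).slot d (N.ident r) := by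
  -- All sources that precede the first source `x` whose slot exceeds `t` are known and counted.
  obtain ⟨x, hx, hmin⟩ := Finset.exists_min_image (S.filter fun x => t < N.slot S x u)
    (N.key u) ⟨r, Finset.mem_filter.2 ⟨hr, hslot⟩⟩
  have hkey : N.key u x ≤ toLex (d, N.ident r) := by
    refine (hmin r (Finset.mem_filter.2 ⟨hr, hslot⟩)).trans ?_
    rw [key, Prod.Lex.toLex_le_toLex]
    exact hd.lt_or_eq.imp_right fun hd => ⟨hd, le_rfl⟩
  have hdist : N.dist x u ≤ d := by
    rw [key, Prod.Lex.toLex_le_toLex] at hkey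
    exact hkey.elim le_of_lt fun h => h.1.le
  refine (Finset.mem_filter.1 hx).2.trans_le (add_le_add hdist (h.sourceRank_le_rank ?_ hkey))
  intro y hy hlt
  by_contra hty
  exact (hmin y (Finset.mem_filter.2 ⟨hy, not_le.1 hty⟩)).not_gt hlt

theorem of_slot_le (h : N.RoutesCorrect S t u) (hp : (N.state S t u).route j = some p)
    (hle : (N.state S t u).slot p.1 j ≤ t) :
    ∃ r ∈ S, j = N.ident r ∧ p = (N.dist r u, N.ident (N.parentOf r u)) ∧
      N.slot S r u = (N.state S t u).slot p.1 j := by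
  obtain ⟨r, hr, rfl, hd⟩ := h.of_route j p hp
  have hslot : N.slot S r u ≤ t := by
    by_contra hlt
    exact (h.lt_slot hr (not_le.1 hlt) hd).not_ge hle
  obtain rfl := Option.some.inj (hp.symm.trans (h.route_eq r hr hslot))
  exact ⟨r, hr, rfl, rfl, (h.slot_eq hslot).symm⟩

theorem token_eq_some_iff (h : N.RoutesCorrect S t u) {q : ℕ × ℕ} :
    (N.state S t u).token = some q ↔
      ∃ r ∈ S, q = (N.dist r u, N.ident r) ∧ N.slot S r u = t := by
  have hdue : ∀ q : ℕ × ℕ, (∃ i, (N.state S t u).route q.2 = some (q.1, i) ∧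
      (N.state S t u).slot q.1 q.2 = (N.state S t u).time) →
      ∃ r ∈ S, q = (N.dist r u, N.ident r) ∧ N.slot S r u = t := by
    rintro ⟨d, j⟩ ⟨i, hp, hslot⟩
    rw [state_time] at hslot
    obtain ⟨r, hr, rfl, hp, hrt⟩ := h.of_slot_le hp hslot.le
    obtain ⟨rfl, -⟩ := Prod.mk.inj hp
    exact ⟨r, hr, rfl, hrt.trans hslot⟩
  rw [NodeState.token, argminOn?_eq_some_iff toLex.injective]
  constructor
  · exact fun hq => hdue q hq.1
  · rintro ⟨r, hr, rfl, hslot⟩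
    refine ⟨⟨_, h.route_eq r hr hslot.le, ?_⟩, fun q hq => ?_⟩
    · rw [h.slot_eq hslot.le, state_time, hslot]
    · obtain ⟨r', hr', rfl, hslot'⟩ := hdue q hq
      rw [N.slot_injOn u hr hr' (hslot.trans hslot'.symm)]

end RoutesCorrect

theorem routesCorrect (hlat : N.LatencyLeWeight) (t : ℕ) (u : V) : N.RoutesCorrect S t u := by
  have tokensCorrect (t : ℕ) : N.TokensCorrect S t := by
    induction t using Nat.strong_induction_on with
    | _ t ih => exact fun u q => (routesCorrect_of_tokensCorrect hlat ih u).token_eq_some_iff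
  exact routesCorrect_of_tokensCorrect hlat (fun s _ => tokensCorrect s) u

/-- All distances from the node `u` to the sources are final at time `t`. -/
def Done (N : Network V) (S : Finset V) (t : ℕ) (u : V) : Prop := ∀ r ∈ S, N.slot S r u ≤ t

theorem RoutesCorrect.sources_eq {t : ℕ} {u : V} (h : N.RoutesCorrect S t u) (hu : N.Done S t u) :
    (N.state S t u).sources = N.ident '' S := by
  refine h.sources_subset.antisymm ?_
  rintro _ ⟨r, hr, rfl⟩
  exact ⟨_, h.route_eq r hr (hu r hr)⟩

theorem complete_iff (hlat : N.LatencyLeWeight) {t : ℕ} {u : V} :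
    (N.state S t u).complete ↔ N.Done S t u := by
  have h := routesCorrect (S := S) hlat t u
  have hcard : (N.ident '' S).ncard = S.card := by
    rw [Set.ncard_image_of_injective _ N.ident_injective, Set.ncard_coe_finset]
  rw [NodeState.complete, state_input, state_time]
  refine ⟨fun ⟨hn, hslots⟩ r hr => ?_, fun hu => ⟨?_, fun j d i hp => ?_⟩⟩
  · have heq := Set.eq_of_subset_of_ncard_le h.sources_subset (hcard.trans hn.symm).le
      (S.finite_toSet.image _)
    obtain ⟨⟨d, i⟩, hp⟩ := heq.ge (Set.mem_image_of_mem _ hr)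
    obtain ⟨x, -, hx, -, hslot⟩ := h.of_slot_le hp (hslots _ _ _ hp)
    rw [N.ident_injective hx]
    exact hslot.trans_le (hslots _ _ _ hp)
  · rw [h.sources_eq hu, hcard]
    rfl
  · obtain ⟨r, hr, rfl, -⟩ := h.of_route _ _ hp
    obtain ⟨rfl, -⟩ := Prod.mk.inj
      (Option.some.inj (hp.symm.trans (h.route_eq r hr (hu r hr))))
    exact (h.slot_eq (hu r hr)).trans_le (hu r hr)

end Tokens

/-! ### Counting complete nodes -/

section Counting

variable {V : Type} [Fintype V] {N : Network V} {S : Finset V} {r₀ u v : V} {s t : ℕ}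

theorem Done.mono (h : N.Done S s u) (hst : s ≤ t) : N.Done S t u :=
  fun r hr => (h r hr).trans hst

/-- `r₀` is the source with the smallest identifier. -/
structure IsLeader (N : Network V) (S : Finset V) (r₀ : V) : Prop where
  mem : r₀ ∈ S
  le : ∀ r ∈ S, N.ident r₀ ≤ N.ident r

theorem parent_eq_some_iff (hlat : N.LatencyLeWeight) {r : V} (hr : r ∈ S)
    (hslot : N.slot S r u ≤ t) :
    (N.state S t u).parent (N.ident r) = some (N.ident v) ↔
      u ∈ childrenOf (N.parentOf r) v := by
  rw [NodeState.parent, (routesCorrect hlat t u).route_eq r hr hslot, Option.bind_some,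
    mem_childrenOf, state_input]
  change (if N.ident _ = N.ident u then _ else _) = _ ↔ _
  split_ifs with hpar
  · simp only [false_iff, not_and]
    exact fun hne hv => hne ((N.ident_injective hpar).symm.trans hv)
  · rw [Option.some_inj, N.ident_injective.eq_iff]
    exact ⟨fun hv => ⟨fun huv => hpar (congrArg N.ident (hv.trans huv.symm)), hv⟩, And.right⟩

theorem leader_eq (hlat : N.LatencyLeWeight) (h₀ : N.IsLeader S r₀) (hdone : N.Done S t u) :
    (N.state S t u).leader = N.ident r₀ := by
  rw [NodeState.leader, (routesCorrect hlat t u).sources_eq hdone]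
  refine IsLeast.csInf_eq ⟨Set.mem_image_of_mem _ h₀.mem, ?_⟩
  rintro _ ⟨r, hr, rfl⟩
  exact h₀.le r hr

open Classical in
theorem packet_count_eq (hlat : N.LatencyLeWeight) (h₀ : N.IsLeader S r₀) :
    ((N.state S t v).packet (N.ident u)).count =
      if N.Done S t v ∧ v ∈ childrenOf (N.parentOf r₀) u then (N.state S t v).counted else 0 := by
  refine if_congr ?_ rfl rfl
  rw [complete_iff hlat]
  refine and_congr_right fun hdone => ?_
  rw [leader_eq hlat h₀ hdone, parent_eq_some_iff hlat h₀.mem (hdone r₀ h₀.mem)]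

theorem childCount_le (hlat : N.LatencyLeWeight) (h₀ : N.IsLeader S r₀) (hadj : N.graph.Adj u v)
    {K : ℕ} (hK : v ∈ childrenOf (N.parentOf r₀) u → ∀ s < t, (N.state S s v).counted ≤ K) :
    (N.state S t u).childCount (N.ident v) ≤ K := by
  refine csSup_le' ?_
  rintro _ ⟨m, hm, rfl⟩
  obtain ⟨s, hs, rfl⟩ := (N.mem_inbox_ident S hadj).1 hm
  have := N.latency_pos_of_adj hadj
  rw [packet_count_eq hlat h₀]
  split_ifs with h
  · exact hK h.2 s (by omega)
  · exact Nat.zero_le K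

open Classical in
theorem counted_eq (hlat : N.LatencyLeWeight) (h₀ : N.IsLeader S r₀) :
    (N.state S t u).counted = if N.Done S t u then
      1 + ∑ c ∈ childrenOf (N.parentOf r₀) u, (N.state S t u).childCount (N.ident c) else 0 := by
  refine if_congr (complete_iff hlat) (congrArg (1 + ·) ?_) rfl
  rw [state_input]
  exact N.sum_links_eq_sum_childrenOf S fun v hadj hv =>
    Nat.le_zero.1 (childCount_le hlat h₀ hadj fun h => (hv h).elim)

open Classical in
theorem counted_le (hlat : N.LatencyLeWeight) (h₀ : N.IsLeader S r₀) (t : ℕ) (u : V) :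
    (N.state S t u).counted ≤
      ∑ y ∈ descendants (N.parentOf r₀) u, if N.Done S t y then 1 else 0 := by
  induction t using Nat.strong_induction_on generalizing u with
  | _ t ih =>
    rw [counted_eq hlat h₀, (N.isRooted_parentOf r₀).sum_descendants]
    split_ifs with hdone
    · refine Nat.add_le_add_left (Finset.sum_le_sum fun c hc => ?_) 1
      refine childCount_le hlat h₀ (N.isTight_of_mem_childrenOf hc).1.symm fun _ s hs => ?_
      refine (ih s hs c).trans (Finset.sum_le_sum fun y _ => ?_)
      split_ifs with hy hy'
      exacts [le_rfl, (hy' (hy.mono hs.le)).elim, Nat.zero_le 1, le_rfl]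
    · exact Nat.zero_le _

theorem counted_le_card (hlat : N.LatencyLeWeight) (h₀ : N.IsLeader S r₀) (t : ℕ) (u : V) :
    (N.state S t u).counted ≤ Fintype.card V := by
  classical
  refine (counted_le hlat h₀ t u).trans ?_
  rw [← Finset.sum_filter, ← Finset.card_eq_sum_ones]
  exact Finset.card_le_univ _

theorem le_childCount (hlat : N.LatencyLeWeight) (h₀ : N.IsLeader S r₀)
    (hv : v ∈ childrenOf (N.parentOf r₀) u) (hdone : N.Done S s v)
    (hs : s + N.latency s(u, v) ≤ t) :
    (N.state S s v).counted ≤ (N.state S t u).childCount (N.ident v) := by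
  have hadj := (N.isTight_of_mem_childrenOf hv).1.symm
  refine le_csSup ⟨Fintype.card V, ?_⟩ ⟨_, (N.mem_inbox_ident S hadj).2 ⟨s, hs, rfl⟩, ?_⟩
  · rintro _ ⟨m, hm, rfl⟩
    obtain ⟨s, -, rfl⟩ := (N.mem_inbox_ident S hadj).1 hm
    rw [packet_count_eq hlat h₀]
    split_ifs
    exacts [counted_le_card hlat h₀ s v, Nat.zero_le _]
  · rw [packet_count_eq hlat h₀, if_pos ⟨hdone, hv⟩]

theorem card_descendants_le_counted (hlat : N.LatencyLeWeight) (h₀ : N.IsLeader S r₀)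
    {T : ℕ} (hT : ∀ y, N.Done S T y) (ht : T + N.diam ≤ t + N.dist r₀ u) :
    (descendants (N.parentOf r₀) u).card ≤ (N.state S t u).counted := by
  induction t using Nat.strong_induction_on generalizing u with
  | _ t ih =>
    have := N.dist_le_diam r₀ u
    rw [counted_eq hlat h₀, if_pos ((hT u).mono (by omega)), Finset.card_eq_sum_ones,
      (N.isRooted_parentOf r₀).sum_descendants]
    refine Nat.add_le_add_left (Finset.sum_le_sum fun c hc => ?_) 1
    rw [← Finset.card_eq_sum_ones]
    obtain ⟨hadj, hdist⟩ := N.isTight_of_mem_childrenOf hc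
    rw [Sym2.eq_swap] at hdist
    have := hlat hadj.symm
    have := N.latency_pos_of_adj hadj.symm
    have := N.dist_le_diam r₀ c
    exact (ih (t - N.latency s(u, c)) (by omega) (by omega)).trans
      (le_childCount hlat h₀ hc ((hT c).mono (by omega)) (by omega))

theorem done_of_ready (hlat : N.LatencyLeWeight) (h₀ : N.IsLeader S r₀)
    (h : (N.state S t u).ready) : u = r₀ ∧ ∀ y, N.Done S t y := by
  classical
  obtain ⟨hcomplete, hleader, hcounted⟩ := h
  rw [leader_eq hlat h₀ ((complete_iff hlat).1 hcomplete), state_input] at hleader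
  obtain rfl : r₀ = u := N.ident_injective hleader
  have hcard := counted_le hlat h₀ t r₀
  rw [hcounted, state_input, (N.isRooted_parentOf r₀).descendants_root, ← Finset.sum_filter,
    ← Finset.card_eq_sum_ones] at hcard
  have huniv := Finset.eq_univ_of_card _ (le_antisymm (Finset.card_le_univ _) hcard)
  exact ⟨rfl, fun y => (Finset.mem_filter.1 (huniv.ge (Finset.mem_univ y))).2⟩

theorem ready_of_le (hlat : N.LatencyLeWeight) (h₀ : N.IsLeader S r₀) {T : ℕ}
    (hT : ∀ y, N.Done S T y) (ht : T + N.diam ≤ t) : (N.state S t r₀).ready := by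
  have hdone : N.Done S t r₀ := (hT r₀).mono (by omega)
  rw [NodeState.ready, leader_eq hlat h₀ hdone, state_input]
  refine ⟨(complete_iff hlat).2 hdone, rfl, (counted_le_card hlat h₀ t r₀).antisymm ?_⟩
  have hcard := card_descendants_le_counted hlat h₀ hT (t := t) (u := r₀) (by omega)
  rwa [(N.isRooted_parentOf r₀).descendants_root] at hcard

end Counting

/-! ### The second stage -/

section Start

variable {V : Type} [Fintype V] {N : Network V} {S : Finset V} {r₀ : V} {B : ℕ}

theorem flood_induction (hlat : N.LatencyLeWeight) {r : V} {T : ℕ} {p : ℕ → V → Prop}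
    (root : ∀ t, T ≤ t → p t r)
    (step : ∀ s t u v, N.graph.Adj u v → s + N.latency s(u, v) ≤ t → p s v → p t u)
    {t : ℕ} {u : V} (ht : T + N.dist r u ≤ t) : p t u := by
  induction t using Nat.strong_induction_on generalizing u with
  | _ t ih =>
    by_cases hu : u = r
    · subst hu
      exact root t (by omega)
    · obtain ⟨v, hadj, hdist⟩ := N.exists_isTight hu
      have := hlat hadj
      have := N.latency_pos_of_adj hadj
      exact step (t - N.latency s(u, v)) t u v hadj (by omega) (ih _ (by omega) (by omega))

/-- The leader `r₀` starts the second stage at time `B`. -/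
structure IsStart (N : Network V) (S : Finset V) (r₀ : V) (B : ℕ) : Prop
    extends IsLeader N S r₀ where
  ready : (N.state S B r₀).ready
  not_ready : ∀ t < B, ¬ (N.state S t r₀).ready

theorem exists_isStart (hlat : N.LatencyLeWeight) (hS : S.Nonempty) :
    ∃ r₀ B, N.IsStart S r₀ B ∧ B ≤ 2 * (S.card + N.diam) := by
  classical
  obtain ⟨r₀, hr₀, hmin⟩ := S.exists_min_image N.ident hS
  have h₀ : N.IsLeader S r₀ := ⟨hr₀, hmin⟩
  have hready : (N.state S (N.diam + S.card + N.diam) r₀).ready :=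
    ready_of_le hlat h₀ (fun y r hr => (N.slot_lt hr y).le) le_rfl
  have hex : ∃ t, (N.state S t r₀).ready := ⟨_, hready⟩
  refine ⟨r₀, Nat.find hex, ⟨h₀, Nat.find_spec hex, fun t => Nat.find_min hex⟩, ?_⟩
  have := Nat.find_min' hex hready
  omega

theorem exists_ready_of_startTime {t b : ℕ} {u : V} (h : (N.state S t u).startTime = some b) :
    b ≤ t ∧ ∃ v, (N.state S b v).ready ∧ (N.state S b v).startTime = some b := by
  induction t using Nat.strong_induction_on generalizing u with
  | _ t ih =>
    rcases argminOn?_mem h with hstarted | ⟨i, m, hm, hstart⟩ | ⟨hready, hb⟩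
    · cases t with
      | zero =>
        rw [state_zero] at hstarted
        nomatch hstarted
      | succ t =>
        rw [state_started_succ] at hstarted
        exact (ih t t.lt_succ_self hstarted).imp_left (·.trans t.le_succ)
    · obtain ⟨v, s, hadj, -, hs, rfl⟩ := (N.mem_inbox S).1 hm
      have := N.latency_pos_of_adj hadj
      exact (ih s (by omega) hstart).imp_left (·.trans (by omega))
    · rw [state_time] at hb
      subst hb
      exact ⟨le_rfl, u, hready, h⟩

namespace IsStart

theorem slot_le (hB : N.IsStart S r₀ B) (hlat : N.LatencyLeWeight) {r : V} (hr : r ∈ S) (u : V) :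
    N.slot S r u ≤ B :=
  (done_of_ready hlat hB.toIsLeader hB.ready).2 u r hr

theorem dist_le (hB : N.IsStart S r₀ B) (hlat : N.LatencyLeWeight) {r : V} (hr : r ∈ S) (u : V) :
    N.dist r u ≤ B :=
  (N.dist_le_slot r u).trans (hB.slot_le hlat hr u)

theorem le_of_startTime (hB : N.IsStart S r₀ B) (hlat : N.LatencyLeWeight) {t b : ℕ} {u : V}
    (h : (N.state S t u).startTime = some b) :
    B ≤ b ∧ b ≤ t ∧ (N.state S b r₀).startTime = some b := by
  obtain ⟨hle, v, hready, hv⟩ := exists_ready_of_startTime h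
  obtain ⟨rfl, -⟩ := done_of_ready hlat hB.toIsLeader hready
  exact ⟨not_lt.1 fun hlt => hB.not_ready b hlt hready, hle, hv⟩

theorem startTime_eq_of_mem (hB : N.IsStart S r₀ B) (hlat : N.LatencyLeWeight) {t : ℕ} {u : V}
    (h : B ∈ (N.state S t u).startCandidates) : (N.state S t u).startTime = some B := by
  obtain ⟨b, hb⟩ := exists_argminOn?_eq_some id ⟨B, h⟩
  rw [NodeState.startTime, hb, (hB.le_of_startTime hlat hb).1.antisymm (argminOn?_le hb h)]

theorem startTime_leader (hB : N.IsStart S r₀ B) (hlat : N.LatencyLeWeight) {t : ℕ} (ht : B ≤ t) :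
    (N.state S t r₀).startTime = some B := by
  induction t, ht using Nat.le_induction with
  | base =>
    exact hB.startTime_eq_of_mem hlat (Or.inr (Or.inr ⟨hB.ready, (N.state_time S B r₀).symm⟩))
  | succ t _ ih =>
    exact hB.startTime_eq_of_mem hlat (Or.inl ((N.state_started_succ S t r₀).trans ih))

theorem of_startTime (hB : N.IsStart S r₀ B) (hlat : N.LatencyLeWeight) {t b : ℕ} {u : V}
    (h : (N.state S t u).startTime = some b) : b = B ∧ B ≤ t := by
  obtain ⟨hle, hbt, hb⟩ := hB.le_of_startTime hlat h
  rw [hB.startTime_leader hlat hle] at hb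
  exact ⟨(Option.some.inj hb).symm, hle.trans hbt⟩

theorem startTime_eq (hB : N.IsStart S r₀ B) (hlat : N.LatencyLeWeight) {t : ℕ} (u : V)
    (ht : 2 * B ≤ t) : (N.state S t u).startTime = some B := by
  have := hB.dist_le hlat hB.mem u
  refine flood_induction hlat (p := fun t u => (N.state S t u).startTime = some B)
    (fun t => hB.startTime_leader hlat) (fun s t u v hadj hs hv => ?_)
    (T := B) (r := r₀) (by omega)
  exact hB.startTime_eq_of_mem hlat
    (Or.inr (Or.inl ⟨_, _, (N.mem_inbox_ident S hadj).2 ⟨s, hs, rfl⟩, hv⟩))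

theorem mem_due (hB : N.IsStart S r₀ B) (hlat : N.LatencyLeWeight) {t j : ℕ} {u v : V} :
    j ∈ (N.state S t u).due (N.ident v) ↔ ∃ r ∈ S, j = N.ident r ∧
      u ∈ childrenOf (N.parentOf r) v ∧ t + N.slot S r u = 3 * B := by
  have hroutes := routesCorrect (S := S) hlat t u
  rw [NodeState.due, Set.mem_ofPred_eq, state_time]
  constructor
  · rintro ⟨hparent, b, d, k, hb, hroute, hsum⟩
    obtain ⟨rfl, hle⟩ := hB.of_startTime hlat hb
    obtain ⟨r, hr, rfl, -⟩ := hroutes.of_route _ _ hroute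
    have hslot := (hB.slot_le hlat hr u).trans hle
    obtain ⟨rfl, -⟩ := Prod.mk.inj
      (Option.some.inj (hroute.symm.trans (hroutes.route_eq r hr hslot)))
    rw [hroutes.slot_eq hslot] at hsum
    exact ⟨r, hr, rfl, (parent_eq_some_iff hlat hr hslot).1 hparent, hsum⟩
  · rintro ⟨r, hr, rfl, hchild, hsum⟩
    have := hB.slot_le hlat hr u
    have hslot : N.slot S r u ≤ t := by omega
    exact ⟨(parent_eq_some_iff hlat hr hslot).2 hchild, B, _, _,
      hB.startTime_eq hlat u (by omega), hroutes.route_eq r hr hslot,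
      by rwa [hroutes.slot_eq hslot]⟩

theorem report_eq_some_iff (hB : N.IsStart S r₀ B) (hlat : N.LatencyLeWeight) {t j : ℕ} {u v : V}
    {p : ℕ × ℕ} : (N.state S t u).report (N.ident v) = some (j, p) ↔
      ∃ r ∈ S, j = N.ident r ∧ u ∈ childrenOf (N.parentOf r) v ∧ t + N.slot S r u = 3 * B ∧
        p = ((N.state S t u).size (N.ident r), (N.state S t u).cost (N.ident r)) := by
  rw [NodeState.report, Option.map_eq_some_iff]
  constructor
  · rintro ⟨_, hi, hp⟩
    obtain ⟨r, hr, rfl, hchild, hsum⟩ := (hB.mem_due hlat).1 (argminOn?_mem hi)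
    obtain ⟨rfl, rfl⟩ := Prod.mk.inj hp
    exact ⟨r, hr, rfl, hchild, hsum, rfl⟩
  · rintro ⟨r, hr, rfl, hchild, hsum, rfl⟩
    refine ⟨_, (argminOn?_eq_some_iff Function.injective_id).2
      ⟨(hB.mem_due hlat).2 ⟨r, hr, rfl, hchild, hsum⟩, fun j hj => ?_⟩, rfl⟩
    obtain ⟨x, hx, rfl, -, hsum'⟩ := (hB.mem_due hlat).1 hj
    obtain rfl := N.slot_injOn u hr hx (by dsimp only; omega)
    exact le_rfl

end IsStart

/-- At time `t`, the node `u` knows the size and the cost of its subtree of the tree with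
root `r`. -/
structure CostsCorrect (N : Network V) (S : Finset V) (r : V) (t : ℕ) (u : V) : Prop where
  size_eq : (N.state S t u).size (N.ident r) = subtreeCount S (N.parentOf r) u
  cost_eq : (N.state S t u).cost (N.ident r) = subtreeRoutingCost N.weight S (N.parentOf r) u

namespace IsStart

section Reports

variable {t : ℕ} {r u v : V}

theorem exists_report_iff (hB : N.IsStart S r₀ B) (hlat : N.LatencyLeWeight) (hr : r ∈ S)
    (ht : 3 * B ≤ t + N.slot S r u)
    (ih : ∀ s < t, ∀ v, 3 * B ≤ s + N.slot S r v → N.CostsCorrect S r s v)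
    (hadj : N.graph.Adj u v) {p : ℕ × ℕ} :
    (∃ m, (N.ident v, m) ∈ (N.state S t u).inbox ∧ m.report = some (N.ident r, p)) ↔
      v ∈ childrenOf (N.parentOf r) u ∧
        p = (subtreeCount S (N.parentOf r) v, subtreeRoutingCost N.weight S (N.parentOf r) v) := by
  have := N.latency_pos_of_adj hadj
  constructor
  · rintro ⟨m, hm, hreport⟩
    obtain ⟨s, hs, rfl⟩ := (N.mem_inbox_ident S hadj).1 hm
    obtain ⟨r', -, hj, hchild, hsum, rfl⟩ := (hB.report_eq_some_iff hlat).1 hreport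
    obtain rfl := N.ident_injective hj
    have hv := ih s (by omega) v hsum.ge
    exact ⟨hchild, by rw [hv.size_eq, hv.cost_eq]⟩
  · rintro ⟨hchild, rfl⟩
    have hslot := N.slot_add_weight_le (S := S) (N.isTight_of_mem_childrenOf hchild)
    rw [Sym2.eq_swap] at hslot
    have := hlat hadj
    have := hB.slot_le hlat hr v
    have hv := ih (3 * B - N.slot S r v) (by omega) v (by omega)
    exact ⟨_, (N.mem_inbox_ident S hadj).2 ⟨3 * B - N.slot S r v, by omega, rfl⟩,
      (hB.report_eq_some_iff hlat).2
        ⟨r, hr, rfl, hchild, by omega, by rw [hv.size_eq, hv.cost_eq]⟩⟩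

open Classical in
theorem childReport_eq (hB : N.IsStart S r₀ B) (hlat : N.LatencyLeWeight) (hr : r ∈ S)
    (ht : 3 * B ≤ t + N.slot S r u)
    (ih : ∀ s < t, ∀ v, 3 * B ≤ s + N.slot S r v → N.CostsCorrect S r s v)
    (hadj : N.graph.Adj u v) :
    (N.state S t u).childReport (N.ident r) (N.ident v) =
      if v ∈ childrenOf (N.parentOf r) u then
        (subtreeCount S (N.parentOf r) v, subtreeRoutingCost N.weight S (N.parentOf r) v)
      else (0, 0) := by
  rw [NodeState.childReport]
  simp only [hB.exists_report_iff hlat hr ht ih hadj]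
  split_ifs with hv
  · refine congrArg (Option.getD · (0, 0)) ((argminOn?_eq_some_iff toLex.injective).2 ?_)
    exact ⟨⟨hv, rfl⟩, fun _ hq => hq.2 ▸ le_rfl⟩
  · refine congrArg (Option.getD · (0, 0)) (argminOn?_eq_none toLex ?_)
    exact fun ⟨_, hq⟩ => hv hq.1

theorem costsCorrect (hB : N.IsStart S r₀ B) (hlat : N.LatencyLeWeight) (hr : r ∈ S)
    (ht : 3 * B ≤ t + N.slot S r u) : N.CostsCorrect S r t u := by
  classical
  induction t using Nat.strong_induction_on generalizing u with
  | _ t ih =>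
    have hchild {v : V} (hv : v ∈ childrenOf (N.parentOf r) u) :=
      (hB.childReport_eq hlat hr ht (fun s hs v => ih s hs)
        (N.isTight_of_mem_childrenOf hv).1.symm).trans (if_pos hv)
    have hother {v : V} (hadj : N.graph.Adj u v) (hv : v ∉ childrenOf (N.parentOf r) u) :=
      (hB.childReport_eq hlat hr ht (fun s hs v => ih s hs) hadj).trans (if_neg hv)
    constructor
    · rw [NodeState.size, state_input, (N.isRooted_parentOf r).subtreeCount_rec,
        N.sum_links_eq_sum_childrenOf S fun v hadj hv => congrArg Prod.fst (hother hadj hv)]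
      exact congrArg₂ (· + ·) (if_congr Iff.rfl rfl rfl)
        (Finset.sum_congr rfl fun c hc => congrArg Prod.fst (hchild hc))
    · rw [NodeState.cost, state_input, (N.isRooted_parentOf r).subtreeRoutingCost_rec,
        N.sum_links_eq_sum_childrenOf S (r := r) fun v hadj hv => by simp [hother hadj hv]]
      refine Finset.sum_congr rfl fun c hc => ?_
      rw [hchild hc]
      rfl

end Reports

end IsStart

/-- Half the routing cost of the shortest-path tree with root `r`. -/
def rootCost (N : Network V) (S : Finset V) (r : V) : ℕ :=
  subtreeRoutingCost N.weight S (N.parentOf r) r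

/-- `r` is a cheapest root, and has the smallest identifier among the cheapest roots. -/
structure IsCheapest (N : Network V) (S : Finset V) (r : V) : Prop where
  mem : r ∈ S
  le : ∀ x ∈ S, toLex (N.rootCost S r, N.ident r) ≤ toLex (N.rootCost S x, N.ident x)

theorem exists_isCheapest (N : Network V) (hS : S.Nonempty) : ∃ r, N.IsCheapest S r :=
  let ⟨r, hr, hmin⟩ := S.exists_min_image (fun x => toLex (N.rootCost S x, N.ident x)) hS
  ⟨r, hr, hmin⟩

theorem IsCheapest.rootCost_le {r x : V} (h : N.IsCheapest S r) (hx : x ∈ S) :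
    N.rootCost S r ≤ N.rootCost S x :=
  (Prod.Lex.toLex_le_toLex.1 (h.le x hx)).elim le_of_lt fun hle => hle.1.le

namespace IsStart

theorem cost_ident_eq (hB : N.IsStart S r₀ B) (hlat : N.LatencyLeWeight) {t : ℕ} {r : V}
    (hr : r ∈ S) (ht : 3 * B ≤ t) : (N.state S t r).cost (N.ident r) = N.rootCost S r :=
  (hB.costsCorrect hlat hr (ht.trans (Nat.le_add_right _ _))).cost_eq

theorem of_mem_bestCandidates (hB : N.IsStart S r₀ B) (hlat : N.LatencyLeWeight) {t : ℕ} {u : V}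
    {p : ℕ × ℕ} (h : p ∈ (N.state S t u).bestCandidates) :
    ∃ r ∈ S, p = (N.rootCost S r, N.ident r) := by
  induction t using Nat.strong_induction_on generalizing u with
  | _ t ih =>
    rcases h with ⟨i, m, hm, hbest⟩ | ⟨hu, rfl, b, hb, hle⟩
    · obtain ⟨v, s, hadj, -, hs, rfl⟩ := (N.mem_inbox S).1 hm
      have := N.latency_pos_of_adj hadj
      exact ih s (by omega) (argminOn?_mem hbest)
    · rw [state_input] at hu ⊢
      rw [state_time] at hle
      obtain ⟨rfl, -⟩ := hB.of_startTime hlat hb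
      exact ⟨u, hu, congrArg (·, N.ident u) (hB.cost_ident_eq hlat hu hle)⟩

theorem best_eq_of_mem (hB : N.IsStart S r₀ B) (hlat : N.LatencyLeWeight) {t : ℕ} {r u : V}
    (hr : N.IsCheapest S r)
    (h : (N.rootCost S r, N.ident r) ∈ (N.state S t u).bestCandidates) :
    (N.state S t u).best = some (N.rootCost S r, N.ident r) := by
  refine (argminOn?_eq_some_iff toLex.injective).2 ⟨h, fun p hp => ?_⟩
  obtain ⟨x, hx, rfl⟩ := hB.of_mem_bestCandidates hlat hp
  exact hr.le x hx

theorem best_eq (hB : N.IsStart S r₀ B) (hlat : N.LatencyLeWeight) {t : ℕ} {r : V}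
    (hr : N.IsCheapest S r) (u : V) (ht : 4 * B ≤ t) :
    (N.state S t u).best = some (N.rootCost S r, N.ident r) := by
  have := hB.dist_le hlat hr.mem u
  refine flood_induction hlat
    (p := fun t u => (N.state S t u).best = some (N.rootCost S r, N.ident r))
    (fun t ht => hB.best_eq_of_mem hlat hr (Or.inr ?_)) (fun s t u v hadj hs hv => ?_)
    (T := 3 * B) (r := r) (by omega)
  · rw [state_input, state_time]
    exact ⟨hr.mem, congrArg (·, N.ident r) (hB.cost_ident_eq hlat hr.mem ht).symm, B,
      hB.startTime_eq hlat r (by omega), ht⟩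
  · exact hB.best_eq_of_mem hlat hr
      (Or.inl ⟨_, _, (N.mem_inbox_ident S hadj).2 ⟨s, hs, rfl⟩, hv⟩)

end IsStart

end Start

section Results

variable {V : Type} [Fintype V] {N : Network V} {S : Finset V} {r₀ : V} {B : ℕ}

theorem UniformWeights.latencyLeWeight (h : N.UniformWeights) : N.LatencyLeWeight :=
  fun _ _ hadj => (h.2 _ hadj).trans_le (N.weight_pos_of_adj hadj)

theorem TransmissionWeights.latencyLeWeight (h : N.TransmissionWeights) : N.LatencyLeWeight :=
  fun _ _ hadj => (h _ hadj).le

/-! ### Size of the messages -/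

theorem two_mul_rootCost (N : Network V) (S : Finset V) (r : V) :
    2 * N.rootCost S r = routingCost N.weight S (N.isShortestPathMap r).tree :=
  (N.isShortestPathMap r).two_mul_subtreeRoutingCost N.weight_pos S

theorem rootCost_le (N : Network V) (S : Finset V) (r : V) :
    N.rootCost S r ≤ S.card * (S.card * N.diam) := by
  have htree := ((N.isShortestPathMap r).isShortestPathTree N.weight_pos).routingCost_le S
  have hsum : ∑ u ∈ S, wdist N.graph N.weight r u ≤ S.card * N.diam :=
    (Finset.sum_le_card_nsmul S _ _ fun u _ => N.dist_le_diam r u).trans_eq (smul_eq_mul _ _)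
  refine Nat.le_of_mul_le_mul_left ?_ two_pos
  calc 2 * N.rootCost S r ≤ 2 * S.card * ∑ u ∈ S, wdist N.graph N.weight r u :=
        (N.two_mul_rootCost S r).trans_le htree
    _ ≤ 2 * (S.card * (S.card * N.diam)) := by
        rw [mul_assoc]
        gcongr

theorem IsStart.packet_fits (hB : N.IsStart S r₀ B) (hlat : N.LatencyLeWeight) {k : ℕ}
    (hident : ∀ v, N.ident v < 2 ^ k) (hcard : Fintype.card V < 2 ^ k) (hstart : B < 2 ^ k)
    (hcost : ∀ r, N.rootCost S r < 2 ^ k) (t : ℕ) (u v : V) :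
    ((N.state S t u).packet (N.ident v)).Fits k where
  token p hp := by
    obtain ⟨r, hr, rfl, -⟩ := (routesCorrect hlat t u).token_eq_some_iff.1 hp
    exact ⟨(hB.dist_le hlat hr u).trans_lt hstart, hident r⟩
  count := by
    rw [packet_count_eq hlat hB.toIsLeader]
    split_ifs
    exacts [(counted_le_card hlat hB.toIsLeader t u).trans_lt hcard, Nat.two_pow_pos k]
  start b hb := (hB.of_startTime hlat hb).1.trans_lt hstart
  report p hp := by
    obtain ⟨r, hr, hj, -, hsum, hp⟩ := (hB.report_eq_some_iff hlat (p := p.2)).1 hp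
    have hu := hB.costsCorrect hlat hr hsum.ge
    rw [hj, hp, hu.size_eq, hu.cost_eq]
    exact ⟨hident r, ((subtreeCount_le _ _ _).trans S.card_le_univ).trans_lt hcard,
      ((N.isRooted_parentOf r).subtreeRoutingCost_le_root _ S u).trans_lt (hcost r)⟩
  best p hp := by
    obtain ⟨r, -, rfl⟩ := hB.of_mem_bestCandidates hlat (argminOn?_mem hp)
    exact ⟨hcost r, hident r⟩

theorem lt_two_pow_of_le_pow {x X m : ℕ} (hX : 2 ≤ X) (hm : m ≠ 0) (hx : x ≤ X ^ m) :
    x < 2 ^ (2 * Nat.log 2 X * m) := by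
  have hlog : 0 < Nat.log 2 X := Nat.log_pos one_lt_two hX
  have hlt : X < 2 ^ (2 * Nat.log 2 X) :=
    (Nat.lt_pow_succ_log_self one_lt_two X).trans_le (Nat.pow_le_pow_right two_pos (by omega))
  exact hx.trans_lt ((Nat.pow_lt_pow_left hlt hm).trans_eq (pow_mul _ _ _).symm)

theorem bandwidthAtMost (hlat : N.LatencyLeWeight) (hS : S.Nonempty) {a : ℕ}
    (hident : ∀ v, N.ident v ≤ Fintype.card V ^ a) :
    N.BandwidthAtMost S mrct
      ((128 * (a + 3) + 16) * Nat.log 2 (Fintype.card V + N.diam)) := by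
  rintro t u v hadj l hl
  obtain ⟨r₀, B, hB, hle⟩ := exists_isStart hlat hS
  have hn : 1 < Fintype.card V := Fintype.one_lt_card_iff.2 ⟨u, v, hadj.ne⟩
  have hcard : S.card ≤ Fintype.card V := S.card_le_univ
  set X := Fintype.card V + N.diam
  have hX : 2 ≤ X := by omega
  have bound {x i : ℕ} (hi : i ≤ a + 3) (hx : x ≤ X ^ i) :
      x < 2 ^ (2 * Nat.log 2 X * (a + 3)) :=
    lt_two_pow_of_le_pow hX (by omega) (hx.trans (Nat.pow_le_pow_right (by omega) hi))
  have hident' (v : V) : N.ident v ≤ X ^ a :=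
    (hident v).trans (Nat.pow_le_pow_left (Nat.le_add_right _ _) a)
  have hstart : B ≤ X ^ 2 := by
    have : 2 * X ≤ X ^ 2 := (Nat.mul_le_mul_right X hX).trans_eq (sq X).symm
    omega
  have hcost (r : V) : N.rootCost S r ≤ X ^ 3 :=
    calc N.rootCost S r ≤ S.card * (S.card * N.diam) := N.rootCost_le S r
      _ ≤ X * (X * X) := by gcongr <;> omega
      _ = X ^ 3 := by ring
  have hfits := hB.packet_fits hlat (fun v => bound (by omega) (hident' v))
    (bound (by omega) ((Nat.le_add_right _ _).trans_eq (pow_one X).symm)) (bound (by omega) hstart)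
    (fun r => bound (by omega) (hcost r)) t u v
  have hlog : 0 < Nat.log 2 X := Nat.log_pos one_lt_two hX
  rw [← Option.some.inj hl]
  calc (encodeMessage ((N.state S t u).packet (N.ident v))).length
      ≤ 64 * (2 * Nat.log 2 X * (a + 3)) + 16 := hfits.length_encodeMessage_le
    _ ≤ 64 * (2 * Nat.log 2 X * (a + 3)) + 16 * Nat.log 2 X := by omega
    _ = (128 * (a + 3) + 16) * Nat.log 2 X := by ring

/-! ### Results -/

namespace IsStart

theorem route_eq (hB : N.IsStart S r₀ B) (hlat : N.LatencyLeWeight) {t : ℕ} (ht : B ≤ t) {r : V}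
    (hr : r ∈ S) (u : V) :
    (N.state S t u).route (N.ident r) = some (N.dist r u, N.ident (N.parentOf r u)) :=
  (routesCorrect hlat t u).route_eq r hr ((hB.slot_le hlat hr u).trans ht)

theorem route_eq_route (hB : N.IsStart S r₀ B) (hlat : N.LatencyLeWeight) {s t : ℕ} (hs : B ≤ s)
    (ht : B ≤ t) (u : V) : (N.state S s u).route = (N.state S t u).route := by
  funext j
  by_cases hj : ∃ r ∈ S, j = N.ident r
  · obtain ⟨r, hr, rfl⟩ := hj
    rw [hB.route_eq hlat hs hr, hB.route_eq hlat ht hr]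
  · have route_eq_none (t : ℕ) : (N.state S t u).route j = none :=
      Option.eq_none_iff_forall_ne_some.2 fun p hp =>
        let ⟨r, hr, hjr, _⟩ := (routesCorrect hlat t u).of_route j p hp
        hj ⟨r, hr, hjr⟩
    rw [route_eq_none, route_eq_none]

theorem result_eq_result (hB : N.IsStart S r₀ B) (hlat : N.LatencyLeWeight) {s t : ℕ}
    (hs : 4 * B ≤ s) (ht : 4 * B ≤ t) (u : V) :
    (N.state S s u).result = (N.state S t u).result := by
  have hroute := hB.route_eq_route hlat (s := s) (t := t) (by omega) (by omega) u
  have hcosts (j : ℕ) (hj : ((N.state S t u).route j).isSome) :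
      (N.state S s u).size j = (N.state S t u).size j ∧
        (N.state S s u).cost j = (N.state S t u).cost j := by
    obtain ⟨p, hp⟩ := Option.isSome_iff_exists.1 hj
    obtain ⟨r, hr, rfl, -⟩ := (routesCorrect hlat t u).of_route j p hp
    have hus := hB.costsCorrect hlat hr (t := s) (u := u) (by omega)
    have hut := hB.costsCorrect hlat hr (t := t) (u := u) (by omega)
    exact ⟨hus.size_eq.trans hut.size_eq.symm, hus.cost_eq.trans hut.cost_eq.symm⟩
  obtain ⟨r, hr⟩ := N.exists_isCheapest ⟨r₀, hB.mem⟩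
  simp only [NodeState.result, hroute, hB.best_eq hlat hr u hs, hB.best_eq hlat hr u ht,
    Result.mk.injEq, true_and, and_true]
  refine ⟨funext fun j => ?_, funext fun j => ?_, funext fun j => ?_⟩
  · rw [NodeState.parent, NodeState.parent, hroute, state_input, state_input]
  · split_ifs with hj
    exacts [(hcosts j hj).1, rfl]
  · split_ifs with hj
    exacts [(hcosts j hj).2, rfl]

theorem terminatesWithin (hB : N.IsStart S r₀ B) (hlat : N.LatencyLeWeight) {T : ℕ}
    (hT : 4 * B ≤ T) : N.TerminatesWithin S mrct T fun u => (N.state S (4 * B) u).result := by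
  intro u
  refine ⟨4 * B, hT, fun s hs => if_neg ?_, fun s hs => (if_pos ?_).trans ?_⟩
  · rintro ⟨b, hb, hle⟩
    obtain ⟨rfl, -⟩ := hB.of_startTime hlat hb
    exact hs.not_ge (hle.trans_eq (N.state_time S s u))
  · exact ⟨B, hB.startTime_eq hlat u (by omega), hs.trans_eq (N.state_time S s u).symm⟩
  · exact congrArg some (hB.result_eq_result hlat hs le_rfl u)

section Sources

variable {r u v : V}

theorem result_parent_eq_some_iff (hB : N.IsStart S r₀ B) (hlat : N.LatencyLeWeight)
    (hr : r ∈ S) : (N.state S (4 * B) u).result.parent (N.ident r) = some (N.ident v) ↔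
      u ∈ childrenOf (N.parentOf r) v :=
  parent_eq_some_iff hlat hr ((hB.slot_le hlat hr u).trans (by omega))

theorem result_subtreeSize_eq (hB : N.IsStart S r₀ B) (hlat : N.LatencyLeWeight) (hr : r ∈ S) :
    (N.state S (4 * B) u).result.subtreeSize (N.ident r) = subtreeCount S (N.parentOf r) u := by
  rw [← (hB.costsCorrect hlat hr (t := 4 * B) (by omega)).size_eq]
  exact if_pos (by rw [hB.route_eq hlat (by omega) hr, Option.isSome_some])

theorem result_subtreeCost_eq (hB : N.IsStart S r₀ B) (hlat : N.LatencyLeWeight) (hr : r ∈ S) :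
    (N.state S (4 * B) u).result.subtreeCost (N.ident r) =
      subtreeRoutingCost N.weight S (N.parentOf r) u := by
  rw [← (hB.costsCorrect hlat hr (t := 4 * B) (by omega)).cost_eq]
  exact if_pos (by rw [hB.route_eq hlat (by omega) hr, Option.isSome_some])

theorem storesTree (hB : N.IsStart S r₀ B) (hlat : N.LatencyLeWeight) (hr : r ∈ S) :
    N.StoresTree (fun u => (N.state S (4 * B) u).result) r (N.isShortestPathMap r).tree := by
  have hroute (u : V) := hB.route_eq hlat (t := 4 * B) (by omega) hr u
  refine ⟨(N.isShortestPathMap r).isShortestPathTree N.weight_pos, fun u => ?_, ?_,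
    fun u v => ?_⟩
  · change (((N.state S (4 * B) u).route (N.ident r)).getD (0, 0)).1 = _
    rw [hroute]
    rfl
  · change (N.state S (4 * B) r).parent (N.ident r) = none
    rw [NodeState.parent, hroute, Option.bind_some, state_input, (N.isShortestPathMap r).root]
    exact if_pos rfl
  · rw [hB.result_parent_eq_some_iff hlat hr, hB.result_parent_eq_some_iff hlat hr,
      IsShortestPathMap.tree_adj, mem_childrenOf, mem_childrenOf, ne_comm (a := v), and_or_left]

theorem storesCosts (hB : N.IsStart S r₀ B) (hlat : N.LatencyLeWeight) (hr : r ∈ S) :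
    N.StoresCosts S (fun u => (N.state S (4 * B) u).result) r := by
  classical
  intro u
  have hchildren : N.children (fun u => (N.state S (4 * B) u).result) r u =
      childrenOf (N.parentOf r) u := by
    ext c
    rw [children, Finset.mem_filter_univ, hB.result_parent_eq_some_iff hlat hr]
  simp only [hchildren, hB.result_subtreeSize_eq hlat hr, hB.result_subtreeCost_eq hlat hr]
  refine ⟨?_, (N.isRooted_parentOf r).subtreeRoutingCost_rec N.weight S u⟩
  convert (N.isRooted_parentOf r).subtreeCount_rec S u

end Sources

end IsStart

end Results

end Network

end MRCT

end

theorem theorem5_general :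
    ∃ (A : MRCT.Algorithm MRCT.Result) (C : ℕ), ∀ a : ℕ, ∃ b : ℕ,
      ∀ (V : Type) [Fintype V] (N : MRCT.Network V) (S : Finset V),
        S.Nonempty →
        (∀ v, N.ident v ≤ Fintype.card V ^ a) →
        N.LatencyLeWeight →
        N.BandwidthAtMost S A (b * Nat.log 2 (Fintype.card V + N.diam)) ∧
        ∃ (out : V → MRCT.Result) (T : V → N.graph.Subgraph) (best : V),
          N.TerminatesWithin S A (C * (S.card + N.diam)) out ∧
          (∀ r ∈ S, N.StoresTree out r (T r) ∧ N.StoresCosts S out r ∧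
            2 * (out r).subtreeCost (N.ident r) = MRCT.routingCost N.weight S (T r)) ∧
          best ∈ S ∧ (∀ u, (out u).best = N.ident best) ∧
          (∀ r ∈ S, MRCT.routingCost N.weight S (T best) ≤ MRCT.routingCost N.weight S (T r)) ∧
          MRCT.SpansAsTree N.graph S (T best) ∧
          MRCT.IsMulApprox 2 (MRCT.optRoutingCost N.graph N.weight S)
            (MRCT.routingCost N.weight S (T best)) := by
  refine ⟨MRCT.mrct, 8, fun a => ⟨128 * (a + 3) + 16, fun V _ N S hS hident hlat => ?_⟩⟩
  obtain ⟨r₀, B, hB, hle⟩ := MRCT.Network.exists_isStart hlat hS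
  obtain ⟨best, hbest⟩ := N.exists_isCheapest hS
  have htree (r : V) := (N.isShortestPathMap r).isShortestPathTree N.weight_pos
  have hmin : ∀ r ∈ S, MRCT.routingCost N.weight S (N.isShortestPathMap best).tree ≤
      MRCT.routingCost N.weight S (N.isShortestPathMap r).tree := fun r hr => by
    rw [← N.two_mul_rootCost, ← N.two_mul_rootCost]
    exact Nat.mul_le_mul_left 2 (hbest.rootCost_le hr)
  refine ⟨MRCT.Network.bandwidthAtMost hlat hS hident, fun u => (N.state S (4 * B) u).result,
    fun r => (N.isShortestPathMap r).tree, best, hB.terminatesWithin hlat (by omega),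
    fun r hr => ⟨hB.storesTree hlat hr, hB.storesCosts hlat hr, ?_⟩, hbest.mem, fun u => ?_, hmin,
    (htree best).spansAsTree S,
    MRCT.isMulApprox_of_forall_le _ (fun r _ => htree r) hbest.mem hmin⟩
  · rw [hB.result_subtreeCost_eq hlat hr]
    exact N.two_mul_rootCost S r
  · change ((N.state S (4 * B) u).best.getD (0, 0)).2 = _
    rw [hB.best_eq hlat hbest u le_rfl]
    rfl

theorem theorem5 :
    ∃ (A : MRCT.Algorithm MRCT.Result) (C : ℕ), ∀ a : ℕ, ∃ b : ℕ,
      ∀ (V : Type) [Fintype V] (N : MRCT.Network V) (S : Finset V),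
        S.Nonempty →
        (∀ v, N.ident v ≤ Fintype.card V ^ a) →
        (N.UniformWeights ∨ N.TransmissionWeights) →
        N.BandwidthAtMost S A (b * Nat.log 2 (Fintype.card V + N.diam)) ∧
        ∃ (out : V → MRCT.Result) (T : V → N.graph.Subgraph) (best : V),
          -- all nodes terminate within `O(|S| + D_ω)` rounds
          N.TerminatesWithin S A (C * (S.card + N.diam)) out ∧
          -- shortest-path trees from all nodes of `S`, with recursively computed routing costs
          (∀ r ∈ S, N.StoresTree out r (T r) ∧ N.StoresCosts S out r ∧
            2 * (out r).subtreeCost (N.ident r) = MRCT.routingCost N.weight S (T r)) ∧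
          -- the cheapest of these trees is selected, and every node knows it
          best ∈ S ∧ (∀ u, (out u).best = N.ident best) ∧
          (∀ r ∈ S, MRCT.routingCost N.weight S (T best) ≤ MRCT.routingCost N.weight S (T r)) ∧
          -- the selected tree is a 2-approximation
          MRCT.SpansAsTree N.graph S (T best) ∧
          MRCT.IsMulApprox 2 (MRCT.optRoutingCost N.graph N.weight S)
            (MRCT.routingCost N.weight S (T best)) := by
  obtain ⟨A, C, h⟩ := theorem5_general
  refine ⟨A, C, fun a => (h a).imp fun b hb V _ N S hS hident hmodel => hb V N S hS hident ?_⟩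
  exact hmodel.elim (·.latencyLeWeight) (·.latencyLeWeight)
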